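/- Let $(\Omega,\mathcal F,P)$ be a probability space, $\ell\ge 1$, and let $(\mathcal F_{kl})_{0\le k\le l\le\infty}$ be sub-$\sigma$-algebras of $\mathcal F$ with $\mathcal F_{kl}\subset\mathcal F_{k'l'}$ whenever $k'\le k$ and $l'\ge l$, and with $\mathcal F_{00}$ trivial; put $\mathcal F_{kl}=\mathcal F_{0l}$ for $-\infty\le k<0$, $l\ge 0$. Let $X(n)$, $n=0,1,2,\dots$, be random vectors in $\mathbb R^{\wp}$ that all have the same distribution $\mu$ (the process need not be stationary). For $p,q\in[1,\infty]$ and $\sigma$-algebras $\mathcal G,\mathcal H\subset\mathcal F$ let $$\varpi_{q,p}(\mathcal G,\mathcal H)=\sup\{\|E[g|\mathcal G]-E[g]\|_p:\ g:\Omega\to\mathbb R\ \text{is}\ \mathcal H\text{-measurable},\ \|g\|_q\le 1\},$$ $$\varpi_{q,p}(n)=\sup_{k\ge 0}\varpi_{q,p}(\mathcal F_{-\infty,k},\mathcal F_{k+n,\infty}),\qquad \beta_q(n)=\sup_{m\ge 0}\|X(m)-E(X(m)|\mathcal F_{m-n,m+n})\|_q .$$ Let $\gamma_r=(\int|x|^r\,d\mu)^{1/r}$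 for $0<r<\infty$ and let $\gamma_\infty$ be the $\mu$-essential supremum of $|x|$. A sequence $a_n\in[0,\infty]$ is said to be of size $-1/2$ if there is a positive eventually nondecreasing sequence $L_n$, $n\ge 0$, with $\sum_{n\ge 1}(nL_n)^{-1}<\infty$, $L_n-L_{n-1}=O(L_n/n)$ and $a_n=O((n^{1/2}L_n)^{-1})$ as $n\to\infty$. Let $F:(\mathbb R^{\wp})^{\ell}\to\mathbb R$ be such that for some $\iota,K>0$, $\kappa\in(0,1]$ and all $x_i,y_i\in\mathbb R^\wp$, $$|F(x_1,\dots,x_\ell)-F(y_1,\dots,y_\ell)|\le K\Big(1+\sum_{j=1}^\ell|x_j|^\iota+\sum_{j=1}^\ell|y_j|^\iota\Big)\sum_{j=1}^\ell|x_j-y_j|^\kappa,\qquad |F(x_1,\dots,x_\ell)|\le K\Big(1+\sum_{j=1}^\ell|x_j|^\iota\Big).$$ Let $q_1(n)<\dots<q_\ell(n)$, $n\ge 1$, be positive integers such that for some $\varepsilon\in(0,1]$ and all $n\ge 1$, $$q_i(n)\ge q_{i-1}(n)+\varepsilon n\ \ (2\le i\le\ell),\qquad q_i(n+1)\ge q_i(n)+\varepsilon\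 \ (1\le i\le\ell).$$ Suppose that, with $d=(\ell-1)\wp$, there exist $p,q\in[1,\infty]$ and $\theta,m>0$ such that $$\theta<\kappa-\frac dp,\qquad \frac12\ge\frac1p+\frac{\iota+2}m+\frac\theta q,\qquad \gamma_m+\gamma_{2q(\iota+2)}<\infty,$$ and such that at least one of the sequences $\varpi_{q,p}(n)+\beta_q(n)^\theta$ and $\varpi_{p,q}(n)+\beta_q(n)^\theta$ is of size $-1/2$. Then $F$ is integrable with respect to $\mu^{\otimes\ell}$ and, with $\bar F=\int F\,d\mu^{\otimes\ell}$, with probability one $$\lim_{N\to\infty}\frac1N\sum_{n=1}^N F\big(X(q_1(n)),\dots,X(q_\ell(n))\big)=\bar F .$$ -/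

import Mathlib

open MeasureTheory ProbabilityTheory Filter Topology
open scoped ENNReal

noncomputable section

/-- The dependence coefficient `ϖ_{q,p}(G, H)`: the supremum of `‖E[g | G] - E[g]‖_p` over the real
`H`-measurable functions `g` with `‖g‖_q ≤ 1`.  The first exponent is the one that normalizes `g`. -/
def dependenceCoeff {Ω : Type*} [MeasurableSpace Ω] (P : Measure Ω) (q p : ℝ≥0∞)
    (G H : MeasurableSpace Ω) : ℝ≥0∞ :=
  ⨆ (g : Ω → ℝ) (_ : Measurable[H] g) (_ : eLpNorm g q P ≤ 1),
    eLpNorm (fun ω => (P[g | G]) ω - ∫ ω', g ω' ∂P) p P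

/-- The family of sub-σ-algebras `𝓕 k l`, `0 ≤ k ≤ l ≤ ∞` (values at `k > l` are irrelevant):
it consists of sub-σ-algebras of the ambient one, it increases when the interval `[k, l]` grows,
and `𝓕 0 0` is trivial (every event in it has probability zero or one). -/
structure IsIntervalFamily {Ω : Type*} [mΩ : MeasurableSpace Ω] (P : Measure Ω)
    (𝓕 : ℕ → ℕ∞ → MeasurableSpace Ω) : Prop where
  le : ∀ (k : ℕ) (l : ℕ∞), (k : ℕ∞) ≤ l → 𝓕 k l ≤ mΩ
  mono : ∀ (k k' : ℕ) (l l' : ℕ∞), (k : ℕ∞) ≤ l → k' ≤ k → l ≤ l' → 𝓕 k l ≤ 𝓕 k' l'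
  trivial_zero : ∀ s : Set Ω, MeasurableSet[𝓕 0 0] s → P s = 0 ∨ P s = 1

/-- The mixing coefficient `ϖ_{q,p}(n) = sup_{k ≥ 0} ϖ_{q,p}(𝓕_{-∞,k}, 𝓕_{k+n,∞})`, where
`𝓕_{-∞,k} = 𝓕_{0,k}` by the convention on negative indices. -/
def mixingCoeff {Ω : Type*} [MeasurableSpace Ω] (P : Measure Ω)
    (𝓕 : ℕ → ℕ∞ → MeasurableSpace Ω) (q p : ℝ≥0∞) (n : ℕ) : ℝ≥0∞ :=
  ⨆ k : ℕ, dependenceCoeff P q p (𝓕 0 (k : ℕ∞)) (𝓕 (k + n) ⊤)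

/-- The approximation coefficient `β_q(n) = sup_{m ≥ 0} ‖X(m) - E[X(m) | 𝓕_{m-n,m+n}]‖_q`.
Since `𝓕_{k,l} = 𝓕_{0,l}` for `k < 0`, truncated subtraction is what is meant in `m - n`. -/
def approxCoeff {Ω : Type*} [MeasurableSpace Ω] (P : Measure Ω)
    (𝓕 : ℕ → ℕ∞ → MeasurableSpace Ω) {w : ℕ} (X : ℕ → Ω → EuclideanSpace ℝ (Fin w))
    (q : ℝ≥0∞) (n : ℕ) : ℝ≥0∞ :=
  ⨆ m : ℕ, eLpNorm (fun ω => X m ω - (P[X m | 𝓕 (m - n) ((m + n : ℕ) : ℕ∞)]) ω) q P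

/-- The absolute moment `γ_r = (∫ |x|^r dμ)^{1/r}`; the essential supremum of `|x|` if `r = ∞`. -/
def absMoment {w : ℕ} (μ : Measure (EuclideanSpace ℝ (Fin w))) (r : ℝ≥0∞) : ℝ≥0∞ :=
  eLpNorm (fun x => x) r μ

/-- A sequence in `[0, ∞]` is of size `-1/2`: there is a positive, eventually nondecreasing
sequence `L` with `∑ 1 / (n L_n) < ∞` (the sum starts effectively at `n = 1`),
`L_n - L_{n-1} = O(L_n / n)` and `a_n = O(1 / (n^{1/2} L_n))`. -/
def IsOfSizeNegHalf (a : ℕ → ℝ≥0∞) : Prop :=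
  ∃ L : ℕ → ℝ, (∀ n, 0 < L n) ∧ (∃ n₀, ∀ n, n₀ ≤ n → L n ≤ L (n + 1)) ∧
    Summable (fun n : ℕ => ((n : ℝ) * L n)⁻¹) ∧
    (fun n : ℕ => L (n + 1) - L n) =O[atTop] (fun n : ℕ => L (n + 1) / ((n : ℝ) + 1)) ∧
    ∃ C : ℝ, ∀ᶠ n : ℕ in atTop, a n ≤ ENNReal.ofReal (C * (Real.sqrt n * L n)⁻¹)

/-- Local Hölder continuity with polynomial growth, for functions of `ℓ` vectors in `ℝ^w`. -/
structure IsHolderPolyGrowth {ℓ w : ℕ} (F : (Fin ℓ → EuclideanSpace ℝ (Fin w)) → ℝ)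
    (ι K κ : ℝ) : Prop where
  holder : ∀ x y : Fin ℓ → EuclideanSpace ℝ (Fin w),
    |F x - F y| ≤ K * (1 + ∑ j, ‖x j‖ ^ ι + ∑ j, ‖y j‖ ^ ι) * ∑ j, ‖x j - y j‖ ^ κ
  growth : ∀ x : Fin ℓ → EuclideanSpace ℝ (Fin w), |F x| ≤ K * (1 + ∑ j, ‖x j‖ ^ ι)

/-- The functions `u 0 < u 1 < ⋯ < u (ℓ - 1)` (numbered `1, …, ℓ` on paper) are positive and
integer valued on the integers `n ≥ 1`, the gaps between consecutive ones are at least `ε n`, and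
each grows at least by `ε` in each step. -/
structure IsSpaced {ℓ : ℕ} (u : Fin ℓ → ℕ → ℕ) (ε : ℝ) : Prop where
  pos : ∀ (i : Fin ℓ) (n : ℕ), 1 ≤ n → 0 < u i n
  gap : ∀ (i j : Fin ℓ), (i : ℕ) + 1 = j → ∀ n : ℕ, 1 ≤ n → (u i n : ℝ) + ε * n ≤ u j n
  step : ∀ (i : Fin ℓ) (n : ℕ), 1 ≤ n → (u i n : ℝ) + ε ≤ u i (n + 1)

/-- The mixing, approximation and moment assumption, with `d = (ℓ - 1) w`: there are
`p, q ∈ [1, ∞]` and `θ, m > 0` with `θ < κ - d/p`, `1/2 ≥ 1/p + (ι + 2)/m + θ/q` and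
`γ_m + γ_{2q(ι+2)} < ∞`, such that `ϖ(n) + β_q(n)^θ` is of size `-1/2`, where `ϖ` is `ϖ_{q,p}`
or `ϖ_{p,q}` (both orders of the indices are admitted). -/
def MixingMomentAssumption {Ω : Type*} [MeasurableSpace Ω] (P : Measure Ω)
    (𝓕 : ℕ → ℕ∞ → MeasurableSpace Ω) {w : ℕ} (X : ℕ → Ω → EuclideanSpace ℝ (Fin w))
    (μ : Measure (EuclideanSpace ℝ (Fin w))) (ℓ : ℕ) (ι κ : ℝ) : Prop :=
  ∃ (p q : ℝ≥0∞) (θ m : ℝ), 1 ≤ p ∧ 1 ≤ q ∧ 0 < θ ∧ 0 < m ∧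
    θ < κ - ((ℓ : ℝ) - 1) * w * (p⁻¹).toReal ∧
    (p⁻¹).toReal + (ι + 2) / m + θ * (q⁻¹).toReal ≤ 1 / 2 ∧
    absMoment μ (ENNReal.ofReal m) + absMoment μ (2 * q * ENNReal.ofReal (ι + 2)) < ∞ ∧
    (IsOfSizeNegHalf (fun n => mixingCoeff P 𝓕 q p n + approxCoeff P 𝓕 X q n ^ θ) ∨
      IsOfSizeNegHalf (fun n => mixingCoeff P 𝓕 p q n + approxCoeff P 𝓕 X q n ^ θ))

/-- The sum `S(N) = ∑_{n=1}^N F(X(u_1(n)), …, X(u_ℓ(n)))`. -/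
def nonconventionalSum {Ω : Type*} {ℓ w : ℕ} (F : (Fin ℓ → EuclideanSpace ℝ (Fin w)) → ℝ)
    (X : ℕ → Ω → EuclideanSpace ℝ (Fin w)) (u : Fin ℓ → ℕ → ℕ) (N : ℕ) (ω : Ω) : ℝ :=
  ∑ n ∈ Finset.Icc 1 N, F (fun j => X (u j n) ω)

end

/-! The proof rests on second moments along geometric subsequences. If the correlations of a process
decay like a negative power of the lag, the mean square of its averages decays like a negative power
of `N`. Along `⌊c ^ k⌋` these bounds are summable, so the averages tend to zero almost surely. If
the process is also bounded below, a linear shift makes its partial sums monotone, and letting `c`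
decrease to `1` fills the gaps (`ae_tendsto_average_of_correlation_decay`).

The mixing assumption enters only through a rate `n ^ (-1/2)` in mean: bounded test functions lie in
every `L^q`, and `L^p` norms dominate the `L^1` norm, so both orders of the indices give the same
information (`HasSqrtRate.of_isOfSizeNegHalf`). For bounded Lipschitz functions this gives
covariance decay between the past and a later time.

For a product `∏ f_j (x_j)` the last nonconstant factor is split into its mean and a centered part.
The centered part is evaluated at a time separated by at least `ε k` from all other relevant times,
so its correlations decay. The mean part has one nonconstant factor fewer, and induction applies
(`IsWeaklyDependent.satisfiesSLLN_prod`).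

A general `F` is clipped to a compact set and approximated there, by Stone-Weierstrass, by sums of
such products. The clipping error is a small multiple of `∑ ‖x_j‖ ^ s` with `s > ι`. Powers of the
norm obey the strong law too, by a truncation whose level grows with the lag, and so the error is
controlled along almost every path (`SatisfiesSLLN.of_approx`). -/

/-! ### Strong law from polynomial decay of correlations -/

theorem sum_range_add_one_rpow_neg_le {δ : ℝ} (hδ : 0 < δ) (hδ1 : δ < 1) (N : ℕ) :
    ∑ k ∈ Finset.range N, ((k : ℝ) + 1) ^ (-δ) ≤ (1 - δ)⁻¹ * (N : ℝ) ^ (1 - δ) := by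
  have hd : 0 < 1 - δ := by linarith
  induction N with
  | zero => simp [Real.zero_rpow hd.ne']
  | succ N ih =>
    rw [Finset.sum_range_succ]
    have hN : (0 : ℝ) < (N : ℝ) + 1 := by positivity
    -- Bernoulli's inequality for an exponent in `[0, 1]`: the new term is at most the increment of
    -- `(1 - δ)⁻¹ * N ^ (1 - δ)`.
    have hb : (1 + -((N : ℝ) + 1)⁻¹) ^ (1 - δ) ≤ 1 + (1 - δ) * (-((N : ℝ) + 1)⁻¹) := by
      refine rpow_one_add_le_one_add_mul_self ?_ hd.le (by linarith)
      have : ((N : ℝ) + 1)⁻¹ ≤ 1 := inv_le_one_of_one_le₀ (by linarith [N.cast_nonneg (α := ℝ)])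
      linarith
    have h1 : (1 + -((N : ℝ) + 1)⁻¹) = N / ((N : ℝ) + 1) := by field_simp; ring
    rw [h1, Real.div_rpow (by positivity) (by positivity), div_le_iff₀ (by positivity)] at hb
    have h2 : ((N : ℝ) + 1) ^ (-δ) = ((N : ℝ) + 1) ^ (1 - δ) * ((N : ℝ) + 1)⁻¹ := by
      rw [← Real.rpow_neg_one, ← Real.rpow_add hN]; congr 1; ring
    have h3 : (1 - δ)⁻¹ * (N : ℝ) ^ (1 - δ) ≤ (1 - δ)⁻¹ * ((N : ℝ) + 1) ^ (1 - δ)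
        - ((N : ℝ) + 1) ^ (-δ) := by
      rw [h2]
      have := mul_le_mul_of_nonneg_left hb (inv_pos.2 hd).le
      refine this.trans (le_of_eq ?_)
      field_simp
      ring
    push_cast
    linarith

/-- Second moment of partial sums under a correlation decay. -/
theorem integral_sq_sum_range_le {Ω : Type*} [MeasurableSpace Ω] {P : Measure Ω}
    {Y : ℕ → Ω → ℝ} {C δ : ℝ} (hδ : 0 < δ) (hY : ∀ n, MemLp (Y n) 2 P)
    (hC : ∀ n k : ℕ, ∫ ω, Y n ω * Y (n + k) ω ∂P ≤ C * ((k : ℝ) + 1) ^ (-δ)) (N : ℕ) :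
    ∫ ω, (∑ n ∈ Finset.range N, Y n ω) ^ 2 ∂P ≤
      3 * C * N * ∑ k ∈ Finset.range N, ((k : ℝ) + 1) ^ (-δ) := by
  have hC0 : 0 ≤ C := by
    have := hC 0 0
    simp only [add_zero, Nat.cast_zero, zero_add, Real.one_rpow, mul_one] at this
    exact (integral_nonneg fun ω => mul_self_nonneg (Y 0 ω)).trans this
  have hS : ∀ N, MemLp (fun ω => ∑ n ∈ Finset.range N, Y n ω) 2 P := fun N =>
    memLp_finsetSum _ fun n _ => hY n
  have hint : ∀ n m, Integrable (fun ω => Y n ω * Y m ω) P := fun n m =>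
    (hY n).integrable_mul (hY m)
  set D : ℕ → ℝ := fun N => ∑ k ∈ Finset.range N, ((k : ℝ) + 1) ^ (-δ) with hD
  induction N with
  | zero => simp
  | succ N ih =>
    have hDs : D (N + 1) = D N + ((N : ℝ) + 1) ^ (-δ) := Finset.sum_range_succ _ _
    have hDN : 0 ≤ ((N : ℝ) + 1) ^ (-δ) := by positivity
    -- After reversal the index is `N - 1 - n`, whereas the lag is `N - n`; the bound decreases in
    -- the lag, so the shift by one is harmless.
    have hcross : ∫ ω, (∑ n ∈ Finset.range N, Y n ω) * Y N ω ∂P ≤ C * D N := by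
      simp only [Finset.sum_mul]
      rw [integral_finsetSum _ fun n _ => hint n N, hD, Finset.mul_sum,
        ← Finset.sum_range_reflect (fun k : ℕ => C * ((k : ℝ) + 1) ^ (-δ))]
      refine Finset.sum_le_sum fun n hn => ?_
      have hn' := Finset.mem_range.1 hn
      have h := hC n (N - n)
      rw [Nat.add_sub_cancel' hn'.le] at h
      refine h.trans (mul_le_mul_of_nonneg_left ?_ hC0)
      refine Real.rpow_le_rpow_of_nonpos (by positivity) ?_ (by linarith)
      have : N - 1 - n ≤ N - n := by omega
      gcongr
    have hdiag : ∫ ω, Y N ω * Y N ω ∂P ≤ C := by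
      simpa using hC N 0
    have hexp : ∫ ω, (∑ n ∈ Finset.range (N + 1), Y n ω) ^ 2 ∂P =
        ∫ ω, (∑ n ∈ Finset.range N, Y n ω) ^ 2 ∂P
          + 2 * ∫ ω, (∑ n ∈ Finset.range N, Y n ω) * Y N ω ∂P + ∫ ω, Y N ω * Y N ω ∂P := by
      have i1 := (hS N).integrable_sq
      have i2 : Integrable (fun ω => (∑ n ∈ Finset.range N, Y n ω) * Y N ω) P :=
        (hS N).integrable_mul (hY N)
      rw [← integral_const_mul, ← integral_add i1 (i2.const_mul 2),
        ← integral_add (by exact i1.add (i2.const_mul 2)) (hint N N)]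
      refine integral_congr_ae (Eventually.of_forall fun ω => ?_)
      simp only [Finset.sum_range_succ]
      ring
    have h1 : 1 ≤ D (N + 1) := by
      have : ((0 : ℕ) + 1 : ℝ) ^ (-δ) ≤ D (N + 1) :=
        Finset.single_le_sum (f := fun k : ℕ => ((k : ℝ) + 1) ^ (-δ))
          (fun k _ => by positivity) (Finset.mem_range.2 (Nat.succ_pos N))
      simpa using this
    rw [hexp]
    push_cast
    have e1 : C * N * D N ≤ C * N * D (N + 1) := by
      have : 0 ≤ C * N := by positivity
      exact mul_le_mul_of_nonneg_left (by linarith) this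
    have e3 : C * D N ≤ C * D (N + 1) := mul_le_mul_of_nonneg_left (by linarith) hC0
    have e4 : C ≤ C * D (N + 1) := le_mul_of_one_le_right hC0 h1
    change _ ≤ 3 * C * ((N : ℝ) + 1) * D (N + 1)
    change _ ≤ 3 * C * N * D N at ih
    linarith

/-- A monotone sequence is squeezed between its values at consecutive `⌊c ^ k⌋`, at the cost of a
factor close to `c`. The ratios `c = 1 + 1 / (j + 1)` tend to `1`, and the linear shift is removed
at the end. -/
theorem tendsto_average_of_nonneg_shift {S : ℕ → ℝ} {B : ℝ}
    (hmono : Monotone fun N : ℕ => S N + B * N)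
    (h : ∀ j : ℕ, Tendsto (fun k : ℕ => S ⌊(1 + 1 / ((j : ℝ) + 1)) ^ k⌋₊ /
      (⌊(1 + 1 / ((j : ℝ) + 1)) ^ k⌋₊ : ℝ)) atTop (𝓝 0)) :
    Tendsto (fun N : ℕ => S N / N) atTop (𝓝 0) := by
  have key : Tendsto (fun N : ℕ => (S N + B * N) / N) atTop (𝓝 B) := by
    refine tendsto_div_of_monotone_of_tendsto_div_floor_pow _ B hmono
      (fun j => 1 + 1 / ((j : ℝ) + 1)) (fun j => ?_) ?_ fun j => ?_
    · have : 0 < 1 / ((j : ℝ) + 1) := by positivity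
      linarith
    · simpa using tendsto_const_nhds.add (tendsto_one_div_add_atTop_nhds_zero_nat (𝕜 := ℝ))
    · have h2 := (h j).add_const B
      rw [zero_add] at h2
      refine h2.congr fun k => ?_
      have : 1 ≤ ⌊(1 + 1 / ((j : ℝ) + 1)) ^ k⌋₊ := by
        refine Nat.le_floor ?_
        rw [Nat.cast_one]
        refine one_le_pow₀ ?_
        have : 0 < 1 / ((j : ℝ) + 1) := by positivity
        linarith
      have h0 : (⌊(1 + 1 / ((j : ℝ) + 1)) ^ k⌋₊ : ℝ) ≠ 0 := by
        exact_mod_cast (by omega : ⌊(1 + 1 / ((j : ℝ) + 1)) ^ k⌋₊ ≠ 0)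
      rw [add_div, mul_div_cancel_right₀ _ h0]
  have h3 := key.sub_const B
  rw [sub_self] at h3
  refine h3.congr' ?_
  filter_upwards [eventually_gt_atTop 0] with N hN
  have : (N : ℝ) ≠ 0 := by exact_mod_cast hN.ne'
  field_simp
  ring

/-- The series `∑ Z_k ^ 2` has finite integral, hence converges almost surely, and its terms tend to
zero. -/
theorem ae_tendsto_zero_of_summable_integral_sq {Ω : Type*} [MeasurableSpace Ω] {P : Measure Ω}
    {Z : ℕ → Ω → ℝ} (hZ : ∀ k, MemLp (Z k) 2 P) {b : ℕ → ℝ} (hb : Summable b)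
    (h : ∀ k, ∫ ω, Z k ω ^ 2 ∂P ≤ b k) :
    ∀ᵐ ω ∂P, Tendsto (fun k => Z k ω) atTop (𝓝 0) := by
  have hb0 : ∀ k, 0 ≤ b k := fun k => (integral_nonneg fun ω => sq_nonneg _).trans (h k)
  have hl : ∀ k, ∫⁻ ω, ENNReal.ofReal (Z k ω ^ 2) ∂P ≤ ENNReal.ofReal (b k) := fun k => by
    rw [← ofReal_integral_eq_lintegral_ofReal (hZ k).integrable_sq
      (Eventually.of_forall fun ω => sq_nonneg _)]
    exact ENNReal.ofReal_le_ofReal (h k)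
  have hmeas : ∀ k, AEMeasurable (fun ω => ENNReal.ofReal (Z k ω ^ 2)) P := fun k =>
    (((hZ k).aestronglyMeasurable.aemeasurable).pow_const 2).ennreal_ofReal
  have hfin : ∫⁻ ω, ∑' k, ENNReal.ofReal (Z k ω ^ 2) ∂P ≠ ∞ := by
    rw [lintegral_tsum hmeas]
    refine ne_top_of_le_ne_top ?_ (ENNReal.tsum_le_tsum hl)
    rw [← ENNReal.ofReal_tsum_of_nonneg hb0 hb]
    exact ENNReal.ofReal_ne_top
  filter_upwards [ae_lt_top' (AEMeasurable.tsum hmeas) hfin] with ω hω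
  have h0 := ENNReal.tendsto_atTop_zero_of_tsum_ne_top hω.ne
  have h1 : Tendsto (fun k => Z k ω ^ 2) atTop (𝓝 0) := by
    have := (ENNReal.tendsto_toReal ENNReal.zero_ne_top).comp h0
    simpa [Function.comp_def, ENNReal.toReal_ofReal (sq_nonneg _)] using this
  have h2 := h1.sqrt
  simp only [Real.sqrt_sq_eq_abs, Real.sqrt_zero] at h2
  exact (tendsto_zero_iff_abs_tendsto_zero _).2 h2

/-- Strong law of large numbers for processes that are bounded below and have polynomially
decaying correlations. -/
theorem ae_tendsto_average_of_correlation_decay {Ω : Type*} [MeasurableSpace Ω] {P : Measure Ω}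
    {Y : ℕ → Ω → ℝ} {B C δ : ℝ} (hδ : 0 < δ) (hδ1 : δ < 1) (hY : ∀ n, MemLp (Y n) 2 P)
    (hB : ∀ n ω, -B ≤ Y n ω)
    (hC : ∀ n k : ℕ, ∫ ω, Y n ω * Y (n + k) ω ∂P ≤ C * ((k : ℝ) + 1) ^ (-δ)) :
    ∀ᵐ ω ∂P, Tendsto (fun N : ℕ => (∑ n ∈ Finset.range N, Y n ω) / N) atTop (𝓝 0) := by
  have hC0 : 0 ≤ C := by
    have := hC 0 0
    simp only [add_zero, Nat.cast_zero, zero_add, Real.one_rpow, mul_one] at this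
    exact (integral_nonneg fun ω => mul_self_nonneg (Y 0 ω)).trans this
  have hvar : ∀ N : ℕ, 0 < N → ∫ ω, ((∑ n ∈ Finset.range N, Y n ω) / N) ^ 2 ∂P ≤
      3 * C * (1 - δ)⁻¹ * (N : ℝ) ^ (-δ) := fun N hN => by
    have hN' : (0 : ℝ) < N := by exact_mod_cast hN
    simp only [div_pow]
    rw [integral_div, div_le_iff₀ (by positivity)]
    refine (integral_sq_sum_range_le hδ hY hC N).trans ?_
    refine (mul_le_mul_of_nonneg_left (sum_range_add_one_rpow_neg_le hδ hδ1 N)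
      (by positivity)).trans (le_of_eq ?_)
    rw [show (1 - δ) = -δ + 1 by ring, Real.rpow_add hN', Real.rpow_one]
    ring
  have hsub : ∀ j : ℕ, ∀ᵐ ω ∂P, Tendsto (fun k : ℕ =>
      (∑ n ∈ Finset.range ⌊(1 + 1 / ((j : ℝ) + 1)) ^ k⌋₊, Y n ω) /
        (⌊(1 + 1 / ((j : ℝ) + 1)) ^ k⌋₊ : ℝ)) atTop (𝓝 0) := fun j => by
    set c : ℝ := 1 + 1 / ((j : ℝ) + 1) with hc
    have hc1 : 1 < c := by
      have : 0 < 1 / ((j : ℝ) + 1) := by positivity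
      linarith
    have hc0 : 0 < c := by linarith
    have hcd : 0 < 1 - c⁻¹ := by
      have := inv_lt_one_of_one_lt₀ hc1
      linarith
    -- Since `⌊c ^ k⌋ ≥ (1 - c⁻¹) * c ^ k`, the second moments are bounded by a geometric series of
    -- ratio `c ^ (-δ)`.
    refine ae_tendsto_zero_of_summable_integral_sq
      (b := fun k => 3 * C * (1 - δ)⁻¹ * ((1 - c⁻¹) ^ (-δ) * (c ^ (-δ)) ^ k)) (fun k => ?_) ?_ ?_
    · simp only [div_eq_inv_mul]
      exact (memLp_finsetSum _ fun n _ => hY n).const_mul _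
    · refine Summable.mul_left _ (Summable.mul_left _ (summable_geometric_of_lt_one
        (by positivity) (Real.rpow_lt_one_of_one_lt_of_neg hc1 (by linarith))))
    · intro k
      have hk : (1 - c⁻¹) * c ^ k ≤ ⌊c ^ k⌋₊ := mul_pow_le_nat_floor_pow hc1 k
      have hpos : 0 < (1 - c⁻¹) * c ^ k := by positivity
      have hfl : (0 : ℝ) < ⌊c ^ k⌋₊ := hpos.trans_le hk
      refine (hvar _ (by exact_mod_cast hfl)).trans ?_
      have h1δ : 0 < 1 - δ := by linarith
      refine mul_le_mul_of_nonneg_left ?_ (by positivity)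
      refine (Real.rpow_le_rpow_of_nonpos hpos hk (by linarith)).trans (le_of_eq ?_)
      rw [Real.mul_rpow hcd.le (by positivity), ← Real.rpow_natCast, ← Real.rpow_natCast,
        ← Real.rpow_mul hc0.le, ← Real.rpow_mul hc0.le, mul_comm (k : ℝ)]
  filter_upwards [ae_all_iff.2 hsub] with ω hω
  refine tendsto_average_of_nonneg_shift (B := B) (monotone_nat_of_le_succ fun N => ?_) hω
  rw [Finset.sum_range_succ]
  push_cast
  linarith [hB N ω]

/-! ### The mean rate contained in the size condition -/

/-- The decay rate `(n + 1)^{-1/2}`. -/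
noncomputable def sqrtRate (n : ℕ) : ℝ := ((n : ℝ) + 1) ^ (-(1 / 2) : ℝ)

theorem sqrtRate_pos (n : ℕ) : 0 < sqrtRate n := by unfold sqrtRate; positivity

theorem sqrtRate_anti {m n : ℕ} (h : m ≤ n) : sqrtRate n ≤ sqrtRate m := by
  unfold sqrtRate
  refine Real.rpow_le_rpow_of_nonpos (by positivity) ?_ (by norm_num)
  gcongr

/-- Turns an asymptotic rate into one valid for all `n`: the trivial bound `A` covers the finitely
many early indices, and `n + 1 ≤ 2 n` replaces `n` by `n + 1` in the rest. -/
theorem exists_le_sqrtRate (A C : ℝ) (n₀ : ℕ) :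
    ∃ D : ℝ, 0 ≤ D ∧ ∀ (n : ℕ) (x : ℝ), x ≤ A → (n₀ ≤ n → x ≤ C * (n : ℝ) ^ (-(1 / 2) : ℝ)) →
      x ≤ D * sqrtRate n := by
  refine ⟨|A| * (sqrtRate (n₀ + 1))⁻¹ + |C| * 2, by have := sqrtRate_pos (n₀ + 1); positivity,
    fun n x hA hn₀ => ?_⟩
  have hp := sqrtRate_pos n
  have hp' := sqrtRate_pos (n₀ + 1)
  rw [add_mul]
  rcases le_or_gt n (n₀ + 1) with hn | hn
  · have h1 : 1 ≤ (sqrtRate (n₀ + 1))⁻¹ * sqrtRate n := by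
      rw [inv_mul_eq_div, one_le_div hp']
      exact sqrtRate_anti hn
    have h2 : |A| ≤ |A| * ((sqrtRate (n₀ + 1))⁻¹ * sqrtRate n) :=
      le_mul_of_one_le_right (abs_nonneg _) h1
    have h3 : 0 ≤ |C| * 2 * sqrtRate n := by positivity
    linarith [hA, le_abs_self A]
  · have hn1 : 0 < n := by omega
    have hn2 : (1 : ℝ) ≤ n := by exact_mod_cast hn1
    have h1 : (n : ℝ) ^ (-(1 / 2) : ℝ) ≤ 2 * sqrtRate n := by
      have e : (2 * (n : ℝ)) ^ (-(1 / 2) : ℝ) ≤ sqrtRate n :=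
        Real.rpow_le_rpow_of_nonpos (by positivity) (by linarith) (by norm_num)
      rw [Real.mul_rpow (by norm_num) (by positivity)] at e
      have e2 : (2 : ℝ)⁻¹ ≤ 2 ^ (-(1 / 2) : ℝ) := by
        rw [← Real.rpow_neg_one]
        exact Real.rpow_le_rpow_of_exponent_le (by norm_num) (by norm_num)
      have e3 : 0 ≤ (n : ℝ) ^ (-(1 / 2) : ℝ) := by positivity
      nlinarith
    have h2 : C * (n : ℝ) ^ (-(1 / 2) : ℝ) ≤ |C| * (n : ℝ) ^ (-(1 / 2) : ℝ) := by
      gcongr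
      exact le_abs_self C
    have h3 : |C| * (n : ℝ) ^ (-(1 / 2) : ℝ) ≤ |C| * (2 * sqrtRate n) := by gcongr
    have h4 : 0 ≤ |A| * (sqrtRate (n₀ + 1))⁻¹ * sqrtRate n := by positivity
    linarith [hn₀ (by omega)]

/-- `L` is eventually bounded below by the positive number `L n₀`. -/
theorem IsOfSizeNegHalf.exists_eventually_le {a : ℕ → ℝ≥0∞} (h : IsOfSizeNegHalf a) :
    ∃ C : ℝ, 0 ≤ C ∧ ∀ᶠ n : ℕ in atTop, a n ≤ ENNReal.ofReal (C * (n : ℝ) ^ (-(1 / 2) : ℝ)) := by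
  obtain ⟨L, hpos, ⟨n₀, hmono⟩, -, -, C, hC⟩ := h
  refine ⟨|C| * (L n₀)⁻¹, by have := hpos n₀; positivity, ?_⟩
  filter_upwards [hC, eventually_ge_atTop n₀] with n hn hn₀
  refine hn.trans (ENNReal.ofReal_le_ofReal ?_)
  have hL : L n₀ ≤ L n := Nat.le_induction le_rfl (fun k hk ih => ih.trans (hmono k hk)) n hn₀
  have h1 : (L n)⁻¹ ≤ (L n₀)⁻¹ := inv_anti₀ (hpos n₀) hL
  have h2 : (n : ℝ) ^ (-(1 / 2) : ℝ) = (Real.sqrt n)⁻¹ := by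
    rw [Real.rpow_neg (Nat.cast_nonneg n), Real.sqrt_eq_rpow]
  have h4 := hpos n
  rw [h2, mul_inv]
  calc C * ((Real.sqrt n)⁻¹ * (L n)⁻¹) ≤ |C| * ((Real.sqrt n)⁻¹ * (L n)⁻¹) := by
        gcongr; exact le_abs_self C
    _ ≤ |C| * ((Real.sqrt n)⁻¹ * (L n₀)⁻¹) := by gcongr
    _ = _ := by ring

/-- On a probability space a function bounded by one lies in the unit ball of every `L^q`, and the
`L^1` norm is at most the `L^p` norm. This makes the order of the two exponents immaterial. -/
theorem ofReal_integral_abs_le_dependenceCoeff {Ω : Type*} {G H : MeasurableSpace Ω}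
    [mΩ : MeasurableSpace Ω] {P : Measure Ω} [IsProbabilityMeasure P] {p q : ℝ≥0∞} (hp : 1 ≤ p)
    {g : Ω → ℝ} (hg : Measurable[H] g) (hg1 : ∀ ω, |g ω| ≤ 1) :
    ENNReal.ofReal (∫ ω, |(P[g | G]) ω - ∫ ω', g ω' ∂P| ∂P) ≤ dependenceCoeff P q p G H := by
  have hi : Integrable (fun ω => (P[g | G]) ω - ∫ ω', g ω' ∂P) P :=
    integrable_condExp.sub (integrable_const _)
  have h1 : eLpNorm g q P ≤ 1 := by
    have h := eLpNorm_le_of_ae_bound (μ := P) (p := q) (f := g) (C := 1)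
      (Eventually.of_forall hg1)
    simpa using h
  have h2 : ENNReal.ofReal (∫ ω, |(P[g | G]) ω - ∫ ω', g ω' ∂P| ∂P) =
      eLpNorm (fun ω => (P[g | G]) ω - ∫ ω', g ω' ∂P) 1 P := by
    rw [eLpNorm_one_eq_lintegral_enorm, ← ofReal_integral_norm_eq_lintegral_enorm hi]
    rfl
  rw [h2]
  refine (eLpNorm_le_eLpNorm_of_exponent_le hp hi.aestronglyMeasurable).trans ?_
  unfold dependenceCoeff
  exact le_iSup_of_le g (le_iSup_of_le hg (le_iSup_of_le h1 le_rfl))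

/-- The process `X` is weakly dependent at rate `(n + 1)^{-1/2}` with respect to the family `𝓕`,
in the weakest sense that the dependence and approximation coefficients provide. -/
structure HasSqrtRate {Ω : Type*} [MeasurableSpace Ω] (P : Measure Ω)
    (𝓕 : ℕ → ℕ∞ → MeasurableSpace Ω) {w : ℕ} (X : ℕ → Ω → EuclideanSpace ℝ (Fin w))
    (C : ℝ) : Prop where
  nonneg : 0 ≤ C
  mixing : ∀ (k n : ℕ) (g : Ω → ℝ), Measurable[𝓕 (k + n) ⊤] g → (∀ ω, |g ω| ≤ 1) →
    ∫ ω, |(P[g | 𝓕 0 (k : ℕ∞)]) ω - ∫ ω', g ω' ∂P| ∂P ≤ C * sqrtRate n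
  approx : ∀ m n : ℕ,
    ∫ ω, ‖X m ω - (P[X m | 𝓕 (m - n) ((m + n : ℕ) : ℕ∞)]) ω‖ ∂P ≤ C * sqrtRate n

theorem HasSqrtRate.of_isOfSizeNegHalf {Ω : Type*} [MeasurableSpace Ω] {P : Measure Ω}
    [IsProbabilityMeasure P] {𝓕 : ℕ → ℕ∞ → MeasurableSpace Ω} (h𝓕 : IsIntervalFamily P 𝓕) {w : ℕ}
    {X : ℕ → Ω → EuclideanSpace ℝ (Fin w)} {M : ℝ} (hX : ∀ n, Integrable (X n) P)
    (hM : ∀ n, ∫ ω, ‖X n ω‖ ∂P ≤ M) {p q r : ℝ≥0∞} (hp : 1 ≤ p) (hr : 1 ≤ r)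
    {θ : ℝ} (hθ : 0 < θ) (hθ1 : θ ≤ 1)
    (h : IsOfSizeNegHalf (fun n => mixingCoeff P 𝓕 q p n + approxCoeff P 𝓕 X r n ^ θ)) :
    ∃ C, HasSqrtRate P 𝓕 X C := by
  obtain ⟨C, hC0, hC⟩ := h.exists_eventually_le
  have hlim : Tendsto (fun n : ℕ => C * (n : ℝ) ^ (-(1 / 2) : ℝ)) atTop (𝓝 0) := by
    simpa using ((tendsto_rpow_neg_atTop (show (0 : ℝ) < 1 / 2 by norm_num)).comp
      tendsto_natCast_atTop_atTop).const_mul C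
  obtain ⟨n₀, hn₀⟩ := eventually_atTop.1 (hC.and (hlim.eventually_le_const one_pos))
  obtain ⟨D₁, hD₁, h₁⟩ := exists_le_sqrtRate 2 C n₀
  obtain ⟨D₂, hD₂, h₂⟩ := exists_le_sqrtRate (M + M) C n₀
  have hpos : ∀ n : ℕ, 0 ≤ C * (n : ℝ) ^ (-(1 / 2) : ℝ) := fun n => by positivity
  refine ⟨D₁ + D₂, by positivity, fun k n g hg hg1 => ?_, fun m n => ?_⟩
  · have hle : 𝓕 0 (k : ℕ∞) ≤ _ := h𝓕.le 0 k (by simp)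
    have hEg : |∫ ω', g ω' ∂P| ≤ 1 := by
      have := norm_integral_le_of_norm_le_const (μ := P) (f := g) (C := 1)
        (Eventually.of_forall hg1)
      simpa using this
    have hb : ∀ᵐ ω ∂P, |(P[g | 𝓕 0 (k : ℕ∞)]) ω| ≤ 1 := by
      have := ae_bdd_abs_condExp_of_ae_bdd_abs (μ := P) (m := 𝓕 0 (k : ℕ∞)) (R := 1) (f := g)
        (Eventually.of_forall hg1)
      simpa using this
    refine (h₁ n _ ?_ fun hn => ?_).trans
      (mul_le_mul_of_nonneg_right (by linarith) (sqrtRate_pos n).le)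
    · have h3 : ∀ᵐ ω ∂P, ‖|(P[g | 𝓕 0 (k : ℕ∞)]) ω - ∫ ω', g ω' ∂P|‖ ≤ 2 := by
        filter_upwards [hb] with ω hω
        rw [Real.norm_eq_abs, abs_abs]
        exact (abs_sub _ _).trans (by linarith)
      have := norm_integral_le_of_norm_le_const h3
      simp only [probReal_univ, mul_one] at this
      exact (le_abs_self _).trans this
    · rw [← ENNReal.ofReal_le_ofReal_iff (hpos n)]
      refine le_trans ?_ (hn₀ n hn).1
      refine le_trans ?_ le_self_add
      refine (ofReal_integral_abs_le_dependenceCoeff (q := q) hp hg hg1).trans ?_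
      exact le_iSup (fun k : ℕ => dependenceCoeff P q p (𝓕 0 (k : ℕ∞)) (𝓕 (k + n) ⊤)) k
  · have hi : Integrable (fun ω => X m ω - (P[X m | 𝓕 (m - n) ((m + n : ℕ) : ℕ∞)]) ω) P :=
      (hX m).sub integrable_condExp
    refine (h₂ n _ ?_ fun hn => ?_).trans
      (mul_le_mul_of_nonneg_right (by linarith) (sqrtRate_pos n).le)
    · have h3 : ∫ ω, ‖(P[X m | 𝓕 (m - n) ((m + n : ℕ) : ℕ∞)]) ω‖ ∂P ≤ ∫ ω, ‖X m ω‖ ∂P :=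
        integral_norm_condExp_le _
      calc _ ≤ ∫ ω, (‖X m ω‖ + ‖(P[X m | 𝓕 (m - n) ((m + n : ℕ) : ℕ∞)]) ω‖) ∂P :=
            integral_mono hi.norm ((hX m).norm.add integrable_condExp.norm)
              fun ω => norm_sub_le _ _
        _ = _ := integral_add (hX m).norm integrable_condExp.norm
        _ ≤ _ := by linarith [hM m]
    · obtain ⟨e1, e2⟩ := hn₀ n hn
      set x := ∫ ω, ‖X m ω - (P[X m | 𝓕 (m - n) ((m + n : ℕ) : ℕ∞)]) ω‖ ∂P with hx
      have hx0 : 0 ≤ x := integral_nonneg fun ω => norm_nonneg _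
      have e3 : ENNReal.ofReal x ≤ approxCoeff P 𝓕 X r n := by
        refine le_trans ?_ (le_iSup (fun m : ℕ => eLpNorm (fun ω => X m ω -
          (P[X m | 𝓕 (m - n) ((m + n : ℕ) : ℕ∞)]) ω) r P) m)
        refine le_trans (le_of_eq ?_)
          (eLpNorm_le_eLpNorm_of_exponent_le hr hi.aestronglyMeasurable)
        rw [eLpNorm_one_eq_lintegral_enorm, ← ofReal_integral_norm_eq_lintegral_enorm hi]
      have e4 : x ^ θ ≤ C * (n : ℝ) ^ (-(1 / 2) : ℝ) := by
        rw [← ENNReal.ofReal_le_ofReal_iff (hpos n), ← ENNReal.ofReal_rpow_of_nonneg hx0 hθ.le]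
        exact ((ENNReal.rpow_le_rpow e3 hθ.le).trans le_add_self).trans e1
      -- Beyond `n₀` the bound on `x ^ θ` is at most one, which forces `x ≤ 1`; then `x ≤ x ^ θ`
      -- because `θ ≤ 1`.
      have e5 : x ≤ 1 := by
        by_contra! hlt
        exact absurd (e4.trans e2) (not_le.2 (Real.one_lt_rpow hlt hθ))
      calc x = x ^ (1 : ℝ) := (Real.rpow_one x).symm
        _ ≤ x ^ θ := by
          rcases hx0.eq_or_lt with h0 | h0
          · rw [← h0, Real.zero_rpow one_ne_zero, Real.zero_rpow hθ.ne']
          · exact Real.rpow_le_rpow_of_exponent_ge h0 e5 hθ1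
        _ ≤ _ := e4

/-! ### Bounded Lipschitz observables and covariance bounds -/

/-- `f` is bounded by `B` and Lipschitz with constant `Λ`. -/
structure IsBddLip {E : Type*} [NormedAddCommGroup E] (f : E → ℝ) (B Λ : ℝ) : Prop where
  bdd : ∀ x, |f x| ≤ B
  lip : ∀ x y, |f x - f y| ≤ Λ * ‖x - y‖

namespace IsBddLip

variable {E : Type*} [NormedAddCommGroup E] {f g : E → ℝ} {B B' Λ Λ' : ℝ}

theorem continuous (hf : IsBddLip f B Λ) : Continuous f := by
  refine (LipschitzWith.of_dist_le' (K := Λ) fun x y => ?_).continuous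
  rw [Real.dist_eq, dist_eq_norm]
  exact hf.lip x y

theorem bound_nonneg (hf : IsBddLip f B Λ) : 0 ≤ B := (abs_nonneg _).trans (hf.bdd 0)

theorem mono (hf : IsBddLip f B Λ) (hB : B ≤ B') (hΛ : Λ ≤ Λ') : IsBddLip f B' Λ' :=
  ⟨fun x => (hf.bdd x).trans hB,
    fun x y => (hf.lip x y).trans (mul_le_mul_of_nonneg_right hΛ (norm_nonneg _))⟩

theorem const (c : ℝ) : IsBddLip (fun _ : E => c) |c| 0 := ⟨fun _ => le_rfl, fun _ _ => by simp⟩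

theorem sub_const (hf : IsBddLip f B Λ) (c : ℝ) : IsBddLip (fun x => f x - c) (B + |c|) Λ :=
  ⟨fun x => (abs_sub _ _).trans (add_le_add_left (hf.bdd x) _),
    fun x y => by rw [sub_sub_sub_cancel_right]; exact hf.lip x y⟩

theorem mul (hf : IsBddLip f B Λ) (hg : IsBddLip g B' Λ') :
    IsBddLip (fun x => f x * g x) (B * B') (B * Λ' + B' * Λ) := by
  refine ⟨fun x => ?_, fun x y => ?_⟩
  · rw [abs_mul]
    exact mul_le_mul (hf.bdd x) (hg.bdd x) (abs_nonneg _) hf.bound_nonneg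
  · have e : f x * g x - f y * g y = f x * (g x - g y) + g y * (f x - f y) := by ring
    rw [e, add_mul]
    refine (abs_add_le _ _).trans (add_le_add ?_ ?_)
    · rw [abs_mul, mul_assoc]
      exact mul_le_mul (hf.bdd x) (hg.lip x y) (abs_nonneg _) hf.bound_nonneg
    · rw [abs_mul, mul_assoc]
      exact mul_le_mul (hg.bdd y) (hf.lip x y) (abs_nonneg _) hg.bound_nonneg

end IsBddLip

/-- A function bounded by `B` that is approximated in mean, at the rate `Λ (j + 1)^{-1/2}`, by
functions with the same bound that are measurable with respect to the past up to `s + j`. -/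
structure IsPastApprox {Ω : Type*} [MeasurableSpace Ω] (P : Measure Ω)
    (𝓕 : ℕ → ℕ∞ → MeasurableSpace Ω) (s : ℕ) (B Λ : ℝ) (W : Ω → ℝ) : Prop where
  measurable : Measurable W
  bdd : ∀ ω, |W ω| ≤ B
  approx : ∀ j : ℕ, ∃ W' : Ω → ℝ, Measurable[𝓕 0 ((s + j : ℕ) : ℕ∞)] W' ∧ (∀ ω, |W' ω| ≤ B) ∧
    ∫ ω, |W ω - W' ω| ∂P ≤ Λ * sqrtRate j

theorem integrable_of_abs_le {Ω : Type*} [MeasurableSpace Ω] {P : Measure Ω} [IsFiniteMeasure P]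
    {f : Ω → ℝ} {B : ℝ} (hf : Measurable f) (h : ∀ ω, |f ω| ≤ B) : Integrable f P :=
  Integrable.of_bound hf.aestronglyMeasurable B (Eventually.of_forall h)

theorem IsPastApprox.const {Ω : Type*} [MeasurableSpace Ω] {P : Measure Ω}
    {𝓕 : ℕ → ℕ∞ → MeasurableSpace Ω} (s : ℕ) (c : ℝ) : IsPastApprox P 𝓕 s |c| 0 (fun _ => c) :=
  ⟨measurable_const, fun _ => le_rfl, fun _ => ⟨fun _ => c, measurable_const, fun _ => le_rfl,
    by simp⟩⟩

theorem IsPastApprox.mono {Ω : Type*} [MeasurableSpace Ω] {P : Measure Ω}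
    {𝓕 : ℕ → ℕ∞ → MeasurableSpace Ω} {s : ℕ} {B B' Λ Λ' : ℝ} {W : Ω → ℝ} (hW : IsPastApprox P 𝓕 s B Λ W)
    (hB : B ≤ B') (hΛ : Λ ≤ Λ') : IsPastApprox P 𝓕 s B' Λ' W := by
  refine ⟨hW.measurable, fun ω => (hW.bdd ω).trans hB, fun j => ?_⟩
  obtain ⟨V, m, b, a⟩ := hW.approx j
  exact ⟨V, m, fun ω => (b ω).trans hB,
    a.trans (mul_le_mul_of_nonneg_right hΛ (sqrtRate_pos j).le)⟩

section

variable {Ω : Type*} [MeasurableSpace Ω] {P : Measure Ω} [IsProbabilityMeasure P]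
  {𝓕 : ℕ → ℕ∞ → MeasurableSpace Ω} {w : ℕ} {X : ℕ → Ω → EuclideanSpace ℝ (Fin w)}

theorem IsPastApprox.bound_nonneg {s : ℕ} {B Λ : ℝ} {W : Ω → ℝ} (hW : IsPastApprox P 𝓕 s B Λ W) :
    0 ≤ B := by
  obtain ⟨ω⟩ := P.nonempty_of_neZero
  exact (abs_nonneg _).trans (hW.bdd ω)

theorem IsPastApprox.mul (h𝓕 : IsIntervalFamily P 𝓕) {s : ℕ} {B₁ Λ₁ B₂ Λ₂ : ℝ} {W₁ W₂ : Ω → ℝ}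
    (h₁ : IsPastApprox P 𝓕 s B₁ Λ₁ W₁) (h₂ : IsPastApprox P 𝓕 s B₂ Λ₂ W₂) :
    IsPastApprox P 𝓕 s (B₁ * B₂) (B₁ * Λ₂ + B₂ * Λ₁) (fun ω => W₁ ω * W₂ ω) := by
  have hb : ∀ {f g : Ω → ℝ}, (∀ ω, |f ω| ≤ B₁) → (∀ ω, |g ω| ≤ B₂) → ∀ ω, |f ω * g ω| ≤ B₁ * B₂ :=
    fun hf hg ω => by
      rw [abs_mul]
      exact mul_le_mul (hf ω) (hg ω) (abs_nonneg _) h₁.bound_nonneg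
  refine ⟨h₁.measurable.mul h₂.measurable, hb h₁.bdd h₂.bdd, fun j => ?_⟩
  obtain ⟨V₁, m₁, b₁, a₁⟩ := h₁.approx j
  obtain ⟨V₂, m₂, b₂, a₂⟩ := h₂.approx j
  refine ⟨fun ω => V₁ ω * V₂ ω, m₁.mul m₂, hb b₁ b₂, ?_⟩
  have hle := h𝓕.le 0 ((s + j : ℕ) : ℕ∞) (by simp)
  have m₁' : Measurable V₁ := m₁.mono hle le_rfl
  have m₂' : Measurable V₂ := m₂.mono hle le_rfl
  have i₁ : Integrable (fun ω => |W₁ ω - V₁ ω|) P :=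
    ((integrable_of_abs_le h₁.measurable h₁.bdd).sub (integrable_of_abs_le m₁' b₁)).abs
  have i₂ : Integrable (fun ω => |W₂ ω - V₂ ω|) P :=
    ((integrable_of_abs_le h₂.measurable h₂.bdd).sub (integrable_of_abs_le m₂' b₂)).abs
  have i : Integrable (fun ω => |W₁ ω * W₂ ω - V₁ ω * V₂ ω|) P :=
    ((integrable_of_abs_le (h₁.measurable.mul h₂.measurable) (hb h₁.bdd h₂.bdd)).sub
      (integrable_of_abs_le (m₁'.mul m₂') (hb b₁ b₂))).abs
  calc ∫ ω, |W₁ ω * W₂ ω - V₁ ω * V₂ ω| ∂P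
      ≤ ∫ ω, (B₁ * |W₂ ω - V₂ ω| + B₂ * |W₁ ω - V₁ ω|) ∂P := by
        refine integral_mono i ((i₂.const_mul _).add (i₁.const_mul _)) fun ω => ?_
        have e : W₁ ω * W₂ ω - V₁ ω * V₂ ω = W₁ ω * (W₂ ω - V₂ ω) + V₂ ω * (W₁ ω - V₁ ω) := by ring
        change |W₁ ω * W₂ ω - V₁ ω * V₂ ω| ≤ _
        rw [e]
        refine (abs_add_le _ _).trans ?_
        rw [abs_mul, abs_mul]
        exact add_le_add (mul_le_mul_of_nonneg_right (h₁.bdd ω) (abs_nonneg _))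
          (mul_le_mul_of_nonneg_right (b₂ ω) (abs_nonneg _))
    _ = B₁ * ∫ ω, |W₂ ω - V₂ ω| ∂P + B₂ * ∫ ω, |W₁ ω - V₁ ω| ∂P := by
        rw [integral_add (i₂.const_mul _) (i₁.const_mul _), integral_const_mul, integral_const_mul]
    _ ≤ B₁ * (Λ₂ * sqrtRate j) + B₂ * (Λ₁ * sqrtRate j) :=
        add_le_add (mul_le_mul_of_nonneg_left a₂ h₁.bound_nonneg)
          (mul_le_mul_of_nonneg_left a₁ h₂.bound_nonneg)
    _ = _ := by ring

theorem IsPastApprox.prod (h𝓕 : IsIntervalFamily P 𝓕) {s : ℕ} {J : Type*} {B Λ : ℝ} (hB : 1 ≤ B)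
    (hΛ : 0 ≤ Λ) {W : J → Ω → ℝ} (S : Finset J) (h : ∀ i ∈ S, IsPastApprox P 𝓕 s B Λ (W i)) :
    IsPastApprox P 𝓕 s (B ^ S.card) (S.card * B ^ S.card * Λ) (fun ω => ∏ i ∈ S, W i ω) := by
  classical
  induction S using Finset.induction_on with
  | empty => simpa using IsPastApprox.const (P := P) (𝓕 := 𝓕) s 1
  | insert a S ha ih =>
    simp only [Finset.prod_insert ha, Finset.card_insert_of_notMem ha]
    refine ((h a (Finset.mem_insert_self _ _)).mul h𝓕
      (ih fun i hi => h i (Finset.mem_insert_of_mem hi))).mono (le_of_eq (by ring)) ?_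
    have h1 : B ^ S.card * Λ ≤ B ^ (S.card + 1) * Λ :=
      mul_le_mul_of_nonneg_right (pow_le_pow_right₀ hB (Nat.le_succ _)) hΛ
    push_cast
    have : B * (S.card * B ^ S.card * Λ) = S.card * B ^ (S.card + 1) * Λ := by ring
    linarith

theorem HasSqrtRate.integral_comp_sub_le {C : ℝ} (hR : HasSqrtRate P 𝓕 X C)
    (h𝓕 : IsIntervalFamily P 𝓕) (hX : ∀ n, Measurable (X n)) (hXi : ∀ n, Integrable (X n) P)
    {f : EuclideanSpace ℝ (Fin w) → ℝ} {B Λ : ℝ} (hf : IsBddLip f B Λ) (hΛ : 0 ≤ Λ) (m n : ℕ) :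
    ∫ ω, |f (X m ω) - f ((P[X m | 𝓕 (m - n) ((m + n : ℕ) : ℕ∞)]) ω)| ∂P ≤ Λ * C * sqrtRate n := by
  have hle : 𝓕 (m - n) ((m + n : ℕ) : ℕ∞) ≤ _ := h𝓕.le _ _ (by norm_cast; omega)
  have hm : Measurable (P[X m | 𝓕 (m - n) ((m + n : ℕ) : ℕ∞)]) :=
    stronglyMeasurable_condExp.measurable.mono hle le_rfl
  have hfm := hf.continuous.measurable
  rw [mul_assoc]
  refine le_trans ?_ (mul_le_mul_of_nonneg_left (hR.approx m n) hΛ)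
  rw [← integral_const_mul]
  refine integral_mono ?_ (((hXi m).sub integrable_condExp).norm.const_mul Λ) fun ω => hf.lip _ _
  exact ((integrable_of_abs_le (hfm.comp (hX m)) fun ω => hf.bdd _).sub
    (integrable_of_abs_le (hfm.comp hm) fun ω => hf.bdd _)).abs

/-- The approximant is `f` of the conditional expectation of `X t` on the window `[t - j, t + j]`,
which lies in the past up to `s + j`. -/
theorem HasSqrtRate.isPastApprox_comp {C : ℝ} (hR : HasSqrtRate P 𝓕 X C)
    (h𝓕 : IsIntervalFamily P 𝓕) (hX : ∀ n, Measurable (X n)) (hXi : ∀ n, Integrable (X n) P)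
    {f : EuclideanSpace ℝ (Fin w) → ℝ} {B Λ : ℝ} (hf : IsBddLip f B Λ) (hΛ : 0 ≤ Λ) {t s : ℕ}
    (hts : t ≤ s) : IsPastApprox P 𝓕 s B (Λ * C) (fun ω => f (X t ω)) := by
  refine ⟨hf.continuous.measurable.comp (hX t), fun ω => hf.bdd _, fun j => ?_⟩
  refine ⟨fun ω => f ((P[X t | 𝓕 (t - j) ((t + j : ℕ) : ℕ∞)]) ω), ?_, fun ω => hf.bdd _,
    hR.integral_comp_sub_le h𝓕 hX hXi hf hΛ t j⟩
  have hle : 𝓕 (t - j) ((t + j : ℕ) : ℕ∞) ≤ 𝓕 0 ((s + j : ℕ) : ℕ∞) :=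
    h𝓕.mono _ _ _ _ (by norm_cast; omega) (Nat.zero_le _) (by norm_cast; omega)
  exact hf.continuous.measurable.comp (stronglyMeasurable_condExp.measurable.mono hle le_rfl)

/-- As `V` belongs to the past, `g` may be replaced by its conditional expectation on the past;
dividing `g` by `T` brings it into the unit ball where the mixing bound applies. -/
theorem HasSqrtRate.abs_integral_mul_le {C : ℝ} (hR : HasSqrtRate P 𝓕 X C)
    (h𝓕 : IsIntervalFamily P 𝓕) {k n : ℕ} {V g : Ω → ℝ} {B T : ℝ}
    (hV : Measurable[𝓕 0 (k : ℕ∞)] V) (hVB : ∀ ω, |V ω| ≤ B)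
    (hg : Measurable[𝓕 (k + n) ⊤] g) (hgT : ∀ ω, |g ω| ≤ T) (hT : 0 < T) :
    |∫ ω, V ω * (g ω - ∫ ω', g ω' ∂P) ∂P| ≤ B * T * (C * sqrtRate n) := by
  have hle := h𝓕.le 0 (k : ℕ∞) (by simp)
  have hle' := h𝓕.le (k + n) ⊤ le_top
  have hVm : Measurable V := hV.mono hle le_rfl
  have hB : 0 ≤ B := by
    obtain ⟨ω⟩ := P.nonempty_of_neZero
    exact (abs_nonneg _).trans (hVB ω)
  set h : Ω → ℝ := fun ω => T⁻¹ * g ω with hh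
  have hhm : Measurable[𝓕 (k + n) ⊤] h := hg.const_mul _
  have hh1 : ∀ ω, |h ω| ≤ 1 := fun ω => by
    rw [hh, abs_mul, abs_of_pos (inv_pos.2 hT), inv_mul_le_one₀ hT]
    exact hgT ω
  have hhi : Integrable h P := integrable_of_abs_le (hhm.mono hle' le_rfl) hh1
  have hVh : Integrable (fun ω => V ω * h ω) P := hhi.bdd_mul hVm.aestronglyMeasurable
    (Eventually.of_forall hVB)
  have hVi : Integrable V P := integrable_of_abs_le hVm hVB
  have hgh : ∀ ω, g ω = T * h ω := fun ω => by rw [hh]; field_simp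
  have hci : Integrable (fun ω => (P[h | 𝓕 0 (k : ℕ∞)]) ω - ∫ ω', h ω' ∂P) P :=
    integrable_condExp.sub (integrable_const _)
  have e : ∫ ω, V ω * (g ω - ∫ ω', g ω' ∂P) ∂P =
      T * ∫ ω, V ω * ((P[h | 𝓕 0 (k : ℕ∞)]) ω - ∫ ω', h ω' ∂P) ∂P := by
    have e1 : ∫ ω, V ω * h ω ∂P = ∫ ω, V ω * (P[h | 𝓕 0 (k : ℕ∞)]) ω ∂P := by
      rw [← integral_condExp hle (f := fun ω => V ω * h ω)]
      exact integral_congr_ae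
        (condExp_mul_of_stronglyMeasurable_left hV.stronglyMeasurable hVh hhi)
    have i1 : Integrable (fun ω => V ω * (P[h | 𝓕 0 (k : ℕ∞)]) ω) P :=
      integrable_condExp.bdd_mul hVm.aestronglyMeasurable (Eventually.of_forall hVB)
    simp only [hgh, integral_const_mul, ← mul_sub]
    simp only [mul_left_comm _ T, integral_const_mul]
    simp only [mul_sub]
    rw [integral_sub hVh (hVi.mul_const _), integral_sub i1 (hVi.mul_const _), e1]
  rw [e, abs_mul, abs_of_pos hT, mul_comm B, mul_assoc]
  refine mul_le_mul_of_nonneg_left ?_ hT.le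
  refine le_trans ?_ (mul_le_mul_of_nonneg_left (hR.mixing k n h hhm hh1) hB)
  rw [← integral_const_mul]
  refine (abs_integral_le_integral_abs).trans ?_
  refine integral_mono ?_ (hci.abs.const_mul B) fun ω => ?_
  · exact (hci.bdd_mul hVm.aestronglyMeasurable (Eventually.of_forall hVB)).abs
  · change |V ω * _| ≤ _
    rw [abs_mul]
    exact mul_le_mul_of_nonneg_right (hVB ω) (abs_nonneg _)

/-- The covariance bound: a function of the past up to `s` and a centered function of `X t`. -/
theorem HasSqrtRate.abs_integral_pastApprox_mul_le {C : ℝ} (hR : HasSqrtRate P 𝓕 X C)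
    (h𝓕 : IsIntervalFamily P 𝓕) (hX : ∀ n, Measurable (X n)) (hXi : ∀ n, Integrable (X n) P)
    {f : EuclideanSpace ℝ (Fin w) → ℝ} {B Λ T L : ℝ} {W : Ω → ℝ} {s t j : ℕ}
    (hf : IsBddLip f T L) (hL : 0 ≤ L) (hT : 0 < T)
    (hf0 : ∫ ω, f (X t ω) ∂P = 0) (hW : IsPastApprox P 𝓕 s B Λ W) (hst : s + 3 * j ≤ t) :
    |∫ ω, W ω * f (X t ω) ∂P| ≤ (T * Λ + 2 * B * L * C + B * T * C) * sqrtRate j := by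
  obtain ⟨V, hV, hVB, hVa⟩ := hW.approx j
  set g : Ω → ℝ := fun ω => f ((P[X t | 𝓕 (t - j) ((t + j : ℕ) : ℕ∞)]) ω) with hgdef
  have hfa : ∫ ω, |f (X t ω) - g ω| ∂P ≤ L * C * sqrtRate j :=
    hR.integral_comp_sub_le h𝓕 hX hXi hf hL t j
  have hB := hW.bound_nonneg
  have hVm : Measurable V := hV.mono (h𝓕.le 0 _ (by simp)) le_rfl
  have hgT : ∀ ω, |g ω| ≤ T := fun ω => hf.bdd _
  have hgm' : Measurable[𝓕 (t - j) ⊤] g := hf.continuous.measurable.comp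
    (stronglyMeasurable_condExp.measurable.mono
      (h𝓕.mono _ _ _ _ (by norm_cast; omega) le_rfl le_top) le_rfl)
  have hgm : Measurable g := hgm'.mono (h𝓕.le _ _ le_top) le_rfl
  -- The gap of `3 * j` is spent in thirds: `j` to approximate `W` from the past, `j` to approximate
  -- `X t`, and at least `j` left for mixing.
  obtain ⟨n, hn, hjn⟩ : ∃ n, t - j = s + j + n ∧ j ≤ n := ⟨t - j - (s + j), by omega, by omega⟩
  rw [hn] at hgm'
  have hfm : Measurable fun ω => f (X t ω) := hf.continuous.measurable.comp (hX t)
  have hfT : ∀ ω, |f (X t ω)| ≤ T := fun ω => hf.bdd _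
  have hgi := integrable_of_abs_le (P := P) hgm hgT
  have hfi := integrable_of_abs_le (P := P) hfm hfT
  have hWi := integrable_of_abs_le (P := P) hW.measurable hW.bdd
  have hVi := integrable_of_abs_le (P := P) hVm hVB
  have hEg : |∫ ω, g ω ∂P| ≤ L * C * sqrtRate j := by
    have : ∫ ω, g ω ∂P = -∫ ω, (f (X t ω) - g ω) ∂P := by
      rw [integral_sub hfi hgi, hf0]; ring
    rw [this, abs_neg]
    exact abs_integral_le_integral_abs.trans hfa
  have hmix : |∫ ω, V ω * (g ω - ∫ ω', g ω' ∂P) ∂P| ≤ B * T * (C * sqrtRate j) :=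
    (hR.abs_integral_mul_le h𝓕 hV hVB hgm' hgT hT).trans (by
      have := hR.nonneg
      have := sqrtRate_anti hjn
      gcongr)
  have i1 : Integrable (fun ω => (W ω - V ω) * f (X t ω)) P :=
    (hWi.sub hVi).mul_bdd hfm.aestronglyMeasurable (Eventually.of_forall hfT)
  have i2 : Integrable (fun ω => V ω * (f (X t ω) - g ω)) P :=
    (hfi.sub hgi).bdd_mul hVm.aestronglyMeasurable (Eventually.of_forall hVB)
  have i3 : Integrable (fun ω => V ω * (g ω - ∫ ω', g ω' ∂P)) P :=
    (hgi.sub (integrable_const _)).bdd_mul hVm.aestronglyMeasurable (Eventually.of_forall hVB)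
  have i4 : Integrable (fun ω => V ω * ∫ ω', g ω' ∂P) P := hVi.mul_const _
  -- Four errors: replacing `W` by `V`, replacing `f (X t)` by `g`, mixing, and the mean of `g`,
  -- which is small because `f (X t)` is centered.
  have e : ∫ ω, W ω * f (X t ω) ∂P = ∫ ω, (W ω - V ω) * f (X t ω) ∂P +
      ∫ ω, V ω * (f (X t ω) - g ω) ∂P + ∫ ω, V ω * (g ω - ∫ ω', g ω' ∂P) ∂P +
      ∫ ω, V ω * ∫ ω', g ω' ∂P ∂P := by
    rw [← integral_add i1 i2, ← integral_add (by exact i1.add i2) i3,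
      ← integral_add (by exact (i1.add i2).add i3) i4]
    congr 1
    ext ω
    ring
  have b1 : |∫ ω, (W ω - V ω) * f (X t ω) ∂P| ≤ Λ * sqrtRate j * T := by
    refine abs_integral_le_integral_abs.trans ?_
    refine le_trans ?_ (mul_le_mul_of_nonneg_right hVa hT.le)
    rw [← integral_mul_const]
    refine integral_mono i1.abs ((hWi.sub hVi).abs.mul_const T) fun ω => ?_
    change |_ * _| ≤ _
    rw [abs_mul]
    exact mul_le_mul_of_nonneg_left (hfT ω) (abs_nonneg _)
  have b2 : |∫ ω, V ω * (f (X t ω) - g ω) ∂P| ≤ B * (L * C * sqrtRate j) := by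
    refine abs_integral_le_integral_abs.trans ?_
    refine le_trans ?_ (mul_le_mul_of_nonneg_left hfa hB)
    rw [← integral_const_mul]
    refine integral_mono i2.abs ((hfi.sub hgi).abs.const_mul B) fun ω => ?_
    change |_ * _| ≤ _
    rw [abs_mul]
    exact mul_le_mul_of_nonneg_right (hVB ω) (abs_nonneg _)
  have b4 : |∫ ω, V ω * ∫ ω', g ω' ∂P ∂P| ≤ B * (L * C * sqrtRate j) := by
    rw [integral_mul_const, abs_mul]
    refine mul_le_mul ?_ hEg (abs_nonneg _) hB
    have := norm_integral_le_of_norm_le_const (μ := P) (f := V) (C := B)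
      (Eventually.of_forall hVB)
    simpa using this
  rw [e]
  calc _ ≤ Λ * sqrtRate j * T + B * (L * C * sqrtRate j) + B * T * (C * sqrtRate j) +
        B * (L * C * sqrtRate j) :=
        (abs_add_le _ _).trans (add_le_add ((abs_add_le _ _).trans
          (add_le_add ((abs_add_le _ _).trans (add_le_add b1 b2)) hmix)) b4)
    _ = _ := by ring

end

/-! ### Spacing of the indices -/

namespace IsSpaced

variable {ℓ : ℕ} {u : Fin ℓ → ℕ → ℕ} {ε : ℝ}

theorem add_le_of_lt (hu : IsSpaced u ε) (hε : 0 < ε) {n : ℕ} (hn : 1 ≤ n) {i j : Fin ℓ}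
    (hij : i < j) : (u i n : ℝ) + ε * n ≤ u j n := by
  obtain ⟨d, hd⟩ := Nat.exists_eq_add_of_lt (Fin.lt_def.1 hij)
  induction d generalizing j with
  | zero => exact hu.gap i j hd.symm n hn
  | succ d ih =>
    have h1 := ih (j := ⟨(i : ℕ) + d + 1, by have := j.2; omega⟩)
      (Fin.lt_def.2 (by simp only; omega)) rfl
    have h2 := hu.gap ⟨(i : ℕ) + d + 1, by have := j.2; omega⟩ j (by simp only; omega) n hn
    have : 0 ≤ ε * n := by positivity
    linarith

theorem le_of_le (hu : IsSpaced u ε) (hε : 0 < ε) {n : ℕ} (hn : 1 ≤ n) {i j : Fin ℓ}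
    (hij : i ≤ j) : u i n ≤ u j n := by
  rcases hij.eq_or_lt with rfl | h
  · exact le_rfl
  · have h1 := hu.add_le_of_lt hε hn h
    have : 0 ≤ ε * n := by positivity
    exact_mod_cast (by linarith : (u i n : ℝ) ≤ u j n)

theorem add_mul_le (hu : IsSpaced u ε) {n : ℕ} (hn : 1 ≤ n) (i : Fin ℓ) (k : ℕ) :
    (u i n : ℝ) + ε * k ≤ u i (n + k) := by
  induction k with
  | zero => simp
  | succ k ih =>
    have := hu.step i (n + k) (by omega)
    push_cast
    rw [← add_assoc]
    linarith

end IsSpaced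

/-- A third of the time gap `ε * k` is available at each stage of the covariance bound. The constant
`6` comes from adding `⌊ε k / 3⌋ + 1 ≥ ε k / 3` and `⌊ε k / 3⌋ + 1 ≥ ε / 3`. -/
theorem sqrtRate_floor_le {ε : ℝ} (hε : 0 < ε) (hε1 : ε ≤ 1) (k : ℕ) :
    sqrtRate ⌊ε * k / 3⌋₊ ≤ (ε / 6) ^ (-(1 / 2) : ℝ) * ((k : ℝ) + 1) ^ (-(1 / 2) : ℝ) := by
  rw [← Real.mul_rpow (by positivity) (by positivity)]
  refine Real.rpow_le_rpow_of_nonpos (by positivity) ?_ (by norm_num)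
  have h1 : ε * k / 3 < (⌊ε * k / 3⌋₊ : ℝ) + 1 := Nat.lt_floor_add_one _
  have h2 : (0 : ℝ) ≤ (⌊ε * k / 3⌋₊ : ℝ) := Nat.cast_nonneg _
  nlinarith

/-! ### The class of functions obeying the strong law -/

/-- Identically distributed, weakly dependent random vectors. -/
structure IsWeaklyDependent {Ω : Type*} [MeasurableSpace Ω] (P : Measure Ω)
    (𝓕 : ℕ → ℕ∞ → MeasurableSpace Ω) {w : ℕ} (X : ℕ → Ω → EuclideanSpace ℝ (Fin w))
    (μ : Measure (EuclideanSpace ℝ (Fin w))) (C : ℝ) : Prop where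
  family : IsIntervalFamily P 𝓕
  measurable : ∀ n, Measurable (X n)
  map_eq : ∀ n, P.map (X n) = μ
  integrable : ∀ n, Integrable (X n) P
  rate : HasSqrtRate P 𝓕 X C

/-- `G` is integrable with respect to `μ^{⊗ℓ}` and the averages of `G (X (u · n))` converge almost
surely to its integral. -/
def SatisfiesSLLN {Ω : Type*} [MeasurableSpace Ω] (P : Measure Ω) {ℓ w : ℕ}
    (X : ℕ → Ω → EuclideanSpace ℝ (Fin w)) (μ : Measure (EuclideanSpace ℝ (Fin w)))
    (u : Fin ℓ → ℕ → ℕ) (G : (Fin ℓ → EuclideanSpace ℝ (Fin w)) → ℝ) : Prop :=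
  Integrable G (Measure.pi fun _ => μ) ∧ ∀ᵐ ω ∂P, Tendsto
    (fun N : ℕ => (∑ n ∈ Finset.range N, G (fun j => X (u j (n + 1)) ω)) / N) atTop
    (𝓝 (∫ x, G x ∂(Measure.pi fun _ => μ)))

section

variable {Ω : Type*} [MeasurableSpace Ω] {P : Measure Ω} {ℓ w : ℕ}
  {X : ℕ → Ω → EuclideanSpace ℝ (Fin w)} {μ : Measure (EuclideanSpace ℝ (Fin w))}
  {u : Fin ℓ → ℕ → ℕ} {G G' : (Fin ℓ → EuclideanSpace ℝ (Fin w)) → ℝ}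

theorem SatisfiesSLLN.add (h : SatisfiesSLLN P X μ u G) (h' : SatisfiesSLLN P X μ u G') :
    SatisfiesSLLN P X μ u (fun x => G x + G' x) := by
  refine ⟨h.1.add h'.1, ?_⟩
  filter_upwards [h.2, h'.2] with ω h1 h2
  rw [integral_add h.1 h'.1]
  simpa only [Finset.sum_add_distrib, add_div] using h1.add h2

theorem SatisfiesSLLN.const_mul (h : SatisfiesSLLN P X μ u G) (c : ℝ) :
    SatisfiesSLLN P X μ u (fun x => c * G x) := by
  refine ⟨h.1.const_mul c, ?_⟩
  filter_upwards [h.2] with ω h1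
  rw [integral_const_mul]
  simpa only [← Finset.mul_sum, mul_div_assoc] using h1.const_mul c

theorem SatisfiesSLLN.const [IsProbabilityMeasure μ] (c : ℝ) :
    SatisfiesSLLN P X μ u (fun _ => c) := by
  refine ⟨integrable_const _, Eventually.of_forall fun ω => ?_⟩
  simp only [integral_const, probReal_univ, one_smul, Finset.sum_const, Finset.card_range,
    nsmul_eq_mul]
  refine tendsto_const_nhds.congr' ?_
  filter_upwards [eventually_gt_atTop 0] with N hN
  have : (N : ℝ) ≠ 0 := by exact_mod_cast hN.ne'
  field_simp

theorem SatisfiesSLLN.sum [IsProbabilityMeasure μ] {J : Type*} (S : Finset J)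
    {g : J → (Fin ℓ → EuclideanSpace ℝ (Fin w)) → ℝ} (h : ∀ i ∈ S, SatisfiesSLLN P X μ u (g i)) :
    SatisfiesSLLN P X μ u (fun x => ∑ i ∈ S, g i x) := by
  classical
  induction S using Finset.induction_on with
  | empty => simpa using SatisfiesSLLN.const 0
  | insert a S ha ih =>
    simp only [Finset.sum_insert ha]
    exact (h a (Finset.mem_insert_self _ _)).add
      (ih fun i hi => h i (Finset.mem_insert_of_mem hi))

/-- The approximation is uniform relative to a weight `H` whose averages converge, so the errors in
the averages and in the integral are both of order `δ * ∫ H`. An unbounded `G` is thus within reach.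
-/
theorem SatisfiesSLLN.of_approx {H : (Fin ℓ → EuclideanSpace ℝ (Fin w)) → ℝ}
    (hH : SatisfiesSLLN P X μ u H) (hH0 : ∀ x, 0 ≤ H x) (hG : Continuous G)
    (h : ∀ δ : ℝ, 0 < δ → ∃ G', SatisfiesSLLN P X μ u G' ∧ ∀ x, |G x - G' x| ≤ δ * H x) :
    SatisfiesSLLN P X μ u G := by
  have hGi : Integrable G (Measure.pi fun _ => μ) := by
    obtain ⟨G', h1, h2⟩ := h 1 one_pos
    refine (h1.1.abs.add hH.1).mono' hG.aestronglyMeasurable (Eventually.of_forall fun x => ?_)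
    have := h2 x
    simp only [Pi.add_apply, Real.norm_eq_abs]
    have e := abs_sub_abs_le_abs_sub (G x) (G' x)
    linarith
  refine ⟨hGi, ?_⟩
  choose! A hA hAG using h
  -- Only the countably many values `δ = 1 / (k + 1)` are used, so the exceptional sets have a null
  -- union.
  have hk : ∀ k : ℕ, (0 : ℝ) < 1 / ((k : ℝ) + 1) := fun k => by positivity
  set I := ∫ x, H x ∂(Measure.pi fun _ => μ) with hI
  have hI0 : 0 ≤ I := integral_nonneg hH0
  filter_upwards [hH.2, ae_all_iff.2 fun k : ℕ => (hA _ (hk k)).2] with ω hω hωk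
  rw [Metric.tendsto_atTop']
  intro e he
  obtain ⟨k, hk'⟩ := exists_nat_one_div_lt (show 0 < e / (2 * (2 * I + 1)) by positivity)
  set δ : ℝ := 1 / ((k : ℝ) + 1) with hδ
  have hδ0 : 0 < δ := hk k
  have hδI : δ * (2 * I + 1) < e / 2 := by
    rw [lt_div_iff₀ (by positivity)] at hk'
    linarith
  have e1 := hω.eventually (gt_mem_nhds (show I < I + 1 by linarith))
  have e2 := (Metric.tendsto_nhds.1 (hωk k)) (e / 2) (by positivity)
  obtain ⟨N₀, hN₀⟩ := eventually_atTop.1 (e1.and e2)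
  refine ⟨N₀, fun N hN => ?_⟩
  obtain ⟨a1, a2⟩ := hN₀ N hN.le
  rw [Real.dist_eq] at a2 ⊢
  have b1 : |∫ x, G x ∂(Measure.pi fun _ => μ) - ∫ x, A δ x ∂(Measure.pi fun _ => μ)| ≤ δ * I := by
    rw [← integral_sub hGi (hA δ hδ0).1, hI, ← integral_const_mul]
    exact abs_integral_le_integral_abs.trans
      (integral_mono (hGi.sub (hA δ hδ0).1).abs (hH.1.const_mul δ) (hAG δ hδ0))
  have b2 : |(∑ n ∈ Finset.range N, G (fun j => X (u j (n + 1)) ω)) / N -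
      (∑ n ∈ Finset.range N, A δ (fun j => X (u j (n + 1)) ω)) / N| ≤
      δ * ((∑ n ∈ Finset.range N, H (fun j => X (u j (n + 1)) ω)) / N) := by
    rw [← sub_div, ← Finset.sum_sub_distrib, abs_div, Nat.abs_cast, ← mul_div_assoc,
      Finset.mul_sum]
    refine div_le_div_of_nonneg_right ?_ (Nat.cast_nonneg N)
    exact (Finset.abs_sum_le_sum_abs _ _).trans (Finset.sum_le_sum fun n _ => hAG δ hδ0 _)
  have b3 := mul_lt_mul_of_pos_left a1 hδ0
  rw [abs_lt] at a2 ⊢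
  rw [abs_le] at b1 b2
  constructor <;> linarith [b1.1, b1.2, b2.1, b2.2, a2.1, a2.2]

end

/-! ### Products of one-variable functions -/

theorem IsWeaklyDependent.integral_comp {Ω : Type*} [MeasurableSpace Ω] {P : Measure Ω}
    {𝓕 : ℕ → ℕ∞ → MeasurableSpace Ω} {w : ℕ} {X : ℕ → Ω → EuclideanSpace ℝ (Fin w)}
    {μ : Measure (EuclideanSpace ℝ (Fin w))} {C : ℝ} (hX : IsWeaklyDependent P 𝓕 X μ C)
    {f : EuclideanSpace ℝ (Fin w) → ℝ} (hf : Continuous f) (n : ℕ) :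
    ∫ ω, f (X n ω) ∂P = ∫ x, f x ∂μ := by
  rw [← hX.map_eq n, integral_map (hX.measurable n).aemeasurable hf.aestronglyMeasurable]

section

variable {Ω : Type*} [MeasurableSpace Ω] {P : Measure Ω} [IsProbabilityMeasure P] {ℓ w : ℕ}
  {𝓕 : ℕ → ℕ∞ → MeasurableSpace Ω} {X : ℕ → Ω → EuclideanSpace ℝ (Fin w)}
  {μ : Measure (EuclideanSpace ℝ (Fin w))} {u : Fin ℓ → ℕ → ℕ} {ε C : ℝ}

theorem IsWeaklyDependent.isProbabilityMeasure (hX : IsWeaklyDependent P 𝓕 X μ C) :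
    IsProbabilityMeasure μ := by
  rw [← hX.map_eq 0]
  exact Measure.isProbabilityMeasure_map (hX.measurable 0).aemeasurable

/-- Correlation decay for products whose last nonconstant factor is centered. -/
theorem IsWeaklyDependent.integral_prod_mul_prod_le (hX : IsWeaklyDependent P 𝓕 X μ C)
    (hε : 0 < ε) (hε1 : ε ≤ 1) (hu : IsSpaced u ε)
    {f : Fin ℓ → EuclideanSpace ℝ (Fin w) → ℝ} {B Λ : ℝ} (hB : 1 ≤ B) (hΛ : 0 ≤ Λ)
    (hf : ∀ j, IsBddLip (f j) B Λ) {i : Fin ℓ} (hc : ∀ j, i < j → ∃ c, f j = fun _ => c)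
    (h0 : ∫ x, f i x ∂μ = 0) :
    ∃ D : ℝ, ∀ n k : ℕ, ∫ ω, (∏ j, f j (X (u j (n + 1)) ω)) *
      (∏ j, f j (X (u j (n + k + 1)) ω)) ∂P ≤ D * ((k : ℝ) + 1) ^ (-(1 / 2) : ℝ) := by
  classical
  have hC := hX.rate.nonneg
  have hΛC : 0 ≤ Λ * C := by positivity
  set S : Finset (Fin ℓ) := Finset.univ.erase i with hS
  set b : ℝ := B ^ ℓ * B ^ S.card with hb
  set c : ℝ := B ^ ℓ * (S.card * B ^ S.card * (Λ * C)) + B ^ S.card * (ℓ * B ^ ℓ * (Λ * C)) with hc'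
  have hB0 : 0 ≤ B := by linarith
  refine ⟨(B * c + 2 * b * Λ * C + b * B * C) * (ε / 6) ^ (-(1 / 2) : ℝ), fun n k => ?_⟩
  set j₀ := ⌊ε * k / 3⌋₊ with hj₀
  set t := u i (n + k + 1) with ht
  have hj₀k : 3 * (j₀ : ℝ) ≤ ε * k := by
    have := Nat.floor_le (show 0 ≤ ε * k / 3 by positivity)
    linarith
  have hfar : ∀ τ : ℕ, (τ : ℝ) + ε * k ≤ t → τ ≤ t - 3 * j₀ := fun τ h => by
    have : (τ : ℝ) + 3 * j₀ ≤ t := by linarith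
    have : τ + 3 * j₀ ≤ t := by exact_mod_cast this
    omega
  have hfirst : ∀ j, j ≤ i → (u j (n + 1) : ℝ) + ε * k ≤ t := fun j hj => by
    have h1 := hu.add_mul_le (show 1 ≤ n + 1 by omega) i k
    have h2 : (u j (n + 1) : ℝ) ≤ u i (n + 1) := by
      exact_mod_cast hu.le_of_le hε (by omega) hj
    rw [show n + 1 + k = n + k + 1 by ring] at h1
    linarith
  have hst : t - 3 * j₀ + 3 * j₀ ≤ t := by
    have h1 := hfirst i le_rfl
    have : 3 * (j₀ : ℝ) ≤ t := by linarith [Nat.cast_nonneg (α := ℝ) (u i (n + 1))]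
    have : 3 * j₀ ≤ t := by exact_mod_cast this
    omega
  -- Factors after `i` are evaluated later than `t`, but being constant they count as past.
  have hpast : ∀ j τ, (j ≤ i → τ ≤ t - 3 * j₀) →
      IsPastApprox P 𝓕 (t - 3 * j₀) B (Λ * C) (fun ω => f j (X τ ω)) := fun j τ h => by
    rcases le_or_gt j i with hj | hj
    · exact hX.rate.isPastApprox_comp hX.family hX.measurable hX.integrable (hf j) hΛ (h hj)
    · obtain ⟨a, ha⟩ := hc j hj
      have hab : |a| ≤ B := by simpa [ha] using (hf j).bdd 0
      simp only [ha]
      exact (IsPastApprox.const _ a).mono hab hΛC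
  have hp1 : IsPastApprox P 𝓕 (t - 3 * j₀) (B ^ ℓ) (ℓ * B ^ ℓ * (Λ * C))
      (fun ω => ∏ j, f j (X (u j (n + 1)) ω)) := by
    simpa using IsPastApprox.prod hX.family hB hΛC Finset.univ
      (W := fun j ω => f j (X (u j (n + 1)) ω))
      fun j _ => hpast j _ fun hj => hfar _ (hfirst j hj)
  have hp2 : IsPastApprox P 𝓕 (t - 3 * j₀) (B ^ S.card) (S.card * B ^ S.card * (Λ * C))
      (fun ω => ∏ j ∈ S, f j (X (u j (n + k + 1)) ω)) := by
    refine IsPastApprox.prod hX.family hB hΛC S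
      (W := fun j ω => f j (X (u j (n + k + 1)) ω)) fun j hj => hpast j _ fun hji => hfar _ ?_
    -- Within the second product the separation comes from the gap `ε * (n + k + 1)` between
    -- different index functions, within the first from the growth of `u i` itself.
    have hlt : j < i := lt_of_le_of_ne hji (Finset.ne_of_mem_erase hj)
    have h1 := hu.add_le_of_lt hε (show 1 ≤ n + k + 1 by omega) hlt
    push_cast at h1
    nlinarith [Nat.cast_nonneg (α := ℝ) n]
  have hmain := hX.rate.abs_integral_pastApprox_mul_le hX.family hX.measurable hX.integrable
    (hf i) hΛ (by linarith) (by rw [hX.integral_comp (hf i).continuous, h0])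
    (hp1.mul hX.family hp2) hst
  have e : ∀ ω, (∏ j, f j (X (u j (n + 1)) ω)) * (∏ j, f j (X (u j (n + k + 1)) ω)) =
      (∏ j, f j (X (u j (n + 1)) ω)) * (∏ j ∈ S, f j (X (u j (n + k + 1)) ω)) * f i (X t ω) :=
    fun ω => by
      rw [mul_assoc]
      congr 1
      exact (Finset.prod_erase_mul _ _ (Finset.mem_univ i)).symm
  simp only [e]
  refine (le_abs_self _).trans (hmain.trans ?_)
  rw [mul_assoc _ ((ε / 6) ^ (-(1 / 2) : ℝ))]
  refine mul_le_mul_of_nonneg_left (sqrtRate_floor_le hε hε1 k) ?_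
  positivity

theorem IsWeaklyDependent.satisfiesSLLN_prod_of_centered (hX : IsWeaklyDependent P 𝓕 X μ C)
    (hε : 0 < ε) (hε1 : ε ≤ 1) (hu : IsSpaced u ε)
    {f : Fin ℓ → EuclideanSpace ℝ (Fin w) → ℝ} {B Λ : ℝ} (hB : 1 ≤ B) (hΛ : 0 ≤ Λ)
    (hf : ∀ j, IsBddLip (f j) B Λ) {i : Fin ℓ} (hc : ∀ j, i < j → ∃ c, f j = fun _ => c)
    (h0 : ∫ x, f i x ∂μ = 0) : SatisfiesSLLN P X μ u (fun x => ∏ j, f j (x j)) := by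
  have := hX.isProbabilityMeasure
  have hcont : Continuous fun x : Fin ℓ → EuclideanSpace ℝ (Fin w) => ∏ j, f j (x j) :=
    continuous_finsetProd _ fun j _ => (hf j).continuous.comp (continuous_apply j)
  have hbd : ∀ x : Fin ℓ → EuclideanSpace ℝ (Fin w), |∏ j, f j (x j)| ≤ B ^ ℓ := fun x => by
    rw [Finset.abs_prod]
    refine (Finset.prod_le_prod (fun _ _ => abs_nonneg _) fun j _ => (hf j).bdd (x j)).trans ?_
    simp
  have hint : ∫ x, ∏ j, f j (x j) ∂(Measure.pi fun _ : Fin ℓ => μ) = 0 := by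
    rw [integral_fintype_prod_eq_prod]
    exact Finset.prod_eq_zero (Finset.mem_univ i) h0
  refine ⟨integrable_of_abs_le hcont.measurable hbd, ?_⟩
  rw [hint]
  obtain ⟨D, hD⟩ := hX.integral_prod_mul_prod_le hε hε1 hu hB hΛ hf hc h0
  refine ae_tendsto_average_of_correlation_decay (B := B ^ ℓ) (C := D) (δ := 1 / 2)
    (Y := fun n ω => ∏ j, f j (X (u j (n + 1)) ω)) (by norm_num) (by norm_num) (fun n => ?_)
    (fun n ω => (abs_le.1 (hbd _)).1) hD
  refine MemLp.of_bound ?_ (B ^ ℓ) (Eventually.of_forall fun ω => hbd _)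
  exact (hcont.measurable.comp
    (measurable_pi_lambda _ fun j => hX.measurable (u j (n + 1)))).aestronglyMeasurable

/-- Induction on the number `r` of leading factors that may be nonconstant: the last of them is
written as its mean plus a centered function. The mean part falls under the induction hypothesis,
the centered part under correlation decay. -/
theorem IsWeaklyDependent.satisfiesSLLN_prod (hX : IsWeaklyDependent P 𝓕 X μ C)
    (hε : 0 < ε) (hε1 : ε ≤ 1) (hu : IsSpaced u ε)
    {f : Fin ℓ → EuclideanSpace ℝ (Fin w) → ℝ} {B Λ : ℝ} (hf : ∀ j, IsBddLip (f j) B Λ) :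
    SatisfiesSLLN P X μ u (fun x => ∏ j, f j (x j)) := by
  have := hX.isProbabilityMeasure
  suffices H : ∀ r : ℕ, ∀ f : Fin ℓ → EuclideanSpace ℝ (Fin w) → ℝ,
      (∃ B Λ, ∀ j, IsBddLip (f j) B Λ) → (∀ j : Fin ℓ, r ≤ j → ∃ c, f j = fun _ => c) →
      SatisfiesSLLN P X μ u (fun x => ∏ j, f j (x j)) from
    H ℓ f ⟨B, Λ, hf⟩ fun j hj => absurd j.2 (by omega)
  intro r
  induction r with
  | zero =>
    intro f _ hc
    choose c hc using fun j => hc j (Nat.zero_le _)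
    simp only [hc]
    exact SatisfiesSLLN.const _
  | succ r ih =>
    rintro f ⟨B, Λ, hf⟩ hc
    rcases le_or_gt ℓ r with hr | hr
    · exact ih f ⟨B, Λ, hf⟩ fun j hj => absurd j.2 (by omega)
    set i : Fin ℓ := ⟨r, hr⟩ with hi
    set a := ∫ x, f i x ∂μ with ha
    have hfi : Integrable (f i) μ := integrable_of_abs_le (hf i).continuous.measurable (hf i).bdd
    have hupd : ∀ (g : EuclideanSpace ℝ (Fin w) → ℝ) (x : Fin ℓ → EuclideanSpace ℝ (Fin w)),
        ∏ j, Function.update f i g j (x j) = g (x i) * ∏ j ∈ Finset.univ.erase i, f j (x j) :=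
      fun g x => by
        rw [← Finset.mul_prod_erase _ _ (Finset.mem_univ i), Function.update_self]
        congr 1
        refine Finset.prod_congr rfl fun j hj => ?_
        rw [Function.update_of_ne (Finset.ne_of_mem_erase hj)]
    have h1 : SatisfiesSLLN P X μ u (fun x => ∏ j, Function.update f i (fun _ => a) j (x j)) := by
      refine ih _ ⟨max B |a|, max Λ 0, fun j => ?_⟩ fun j hj => ?_
      · rcases eq_or_ne j i with rfl | h
        · rw [Function.update_self]
          exact (IsBddLip.const a).mono (le_max_right _ _) (le_max_right _ _)
        · rw [Function.update_of_ne h]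
          exact (hf j).mono (le_max_left _ _) (le_max_left _ _)
      · rcases eq_or_ne j i with rfl | h
        · exact ⟨a, Function.update_self _ _ _⟩
        · rw [Function.update_of_ne h]
          exact hc j (lt_of_le_of_ne hj fun h' => h (Fin.ext h'.symm))
    have h2 : SatisfiesSLLN P X μ u
        (fun x => ∏ j, Function.update f i (fun y => f i y - a) j (x j)) := by
      refine hX.satisfiesSLLN_prod_of_centered hε hε1 hu (B := max (B + |a|) 1) (Λ := max Λ 0)
        (le_max_right _ _) (le_max_right _ _) (fun j => ?_) (i := i) (fun j hj => ?_) ?_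
      · rcases eq_or_ne j i with rfl | h
        · rw [Function.update_self]
          exact ((hf i).sub_const a).mono (le_max_left _ _) (le_max_left _ _)
        · rw [Function.update_of_ne h]
          exact (hf j).mono (le_max_of_le_left (by linarith [abs_nonneg a])) (le_max_left _ _)
      · rw [Function.update_of_ne hj.ne']
        exact hc j (Fin.lt_def.1 hj)
      · rw [Function.update_self, integral_sub hfi (integrable_const _)]
        simp [ha]
    have e : (fun x : Fin ℓ → EuclideanSpace ℝ (Fin w) => ∏ j, f j (x j)) =
        fun x => ∏ j, Function.update f i (fun _ => a) j (x j) +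
          ∏ j, Function.update f i (fun y => f i y - a) j (x j) := funext fun x => by
      rw [hupd, hupd, ← Finset.mul_prod_erase _ _ (Finset.mem_univ i)]
      ring
    rw [e]
    exact h1.add h2

end

/-! ### Powers of the norm -/

theorem IsBddLip.min_norm_pow {E : Type*} [NormedAddCommGroup E] (s : ℕ) {T : ℝ} (hT : 1 ≤ T) :
    IsBddLip (fun x : E => min ‖x‖ T ^ s) (T ^ s) (s * T ^ s) := by
  have h0 : ∀ x : E, 0 ≤ min ‖x‖ T := fun x => le_min (norm_nonneg x) (by linarith)
  refine ⟨fun x => ?_, fun x y => ?_⟩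
  · rw [abs_of_nonneg (pow_nonneg (h0 x) s)]
    exact pow_le_pow_left₀ (h0 x) (min_le_right _ _) s
  · refine (abs_pow_sub_pow_le _ _ _).trans ?_
    rw [abs_of_nonneg (h0 x), abs_of_nonneg (h0 y), mul_comm _ (s : ℝ), mul_right_comm]
    have h1 : |min ‖x‖ T - min ‖y‖ T| ≤ ‖x - y‖ :=
      (abs_inf_sub_inf_le_abs _ _ _).trans (abs_norm_sub_norm_le x y)
    have h2 : max (min ‖x‖ T) (min ‖y‖ T) ^ (s - 1) ≤ T ^ s :=
      (pow_le_pow_left₀ (le_max_of_le_left (h0 x))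
        (max_le (min_le_right _ _) (min_le_right _ _)) _).trans
        (pow_le_pow_right₀ hT (Nat.sub_le s 1))
    have h3 : 0 ≤ max (min ‖x‖ T) (min ‖y‖ T) ^ (s - 1) :=
      pow_nonneg (le_max_of_le_left (h0 x)) _
    gcongr

/-- One extra power of the norm buys a factor `1 / T`; this is why square integrability is required
of the power `s + 1`. -/
theorem norm_pow_sub_min_norm_pow_le {E : Type*} [NormedAddCommGroup E] (s : ℕ) {T : ℝ}
    (hT : 1 ≤ T) (x : E) : ‖x‖ ^ s - min ‖x‖ T ^ s ≤ ‖x‖ ^ (s + 1) / T := by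
  have hT0 : 0 < T := by linarith
  rcases le_total ‖x‖ T with h | h
  · rw [min_eq_left h, sub_self]
    positivity
  · rw [min_eq_right h, le_div_iff₀ hT0, pow_succ]
    have h1 : 0 ≤ T ^ s := by positivity
    have h2 : ‖x‖ ^ s * T ≤ ‖x‖ ^ s * ‖x‖ := mul_le_mul_of_nonneg_left h (by positivity)
    nlinarith

theorem pow_le_pow_succ_add_one {a : ℝ} (ha : 0 ≤ a) (s : ℕ) : a ^ s ≤ a ^ (s + 1) + 1 := by
  rcases le_total a 1 with h | h
  · have := pow_le_one₀ (n := s) ha h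
    have : 0 ≤ a ^ (s + 1) := by positivity
    linarith
  · have : a ^ s ≤ a ^ (s + 1) := pow_le_pow_right₀ h (Nat.le_succ s)
    linarith

section

variable {Ω : Type*} [MeasurableSpace Ω] {P : Measure Ω} [IsProbabilityMeasure P] {ℓ w : ℕ}
  {𝓕 : ℕ → ℕ∞ → MeasurableSpace Ω} {X : ℕ → Ω → EuclideanSpace ℝ (Fin w)}
  {μ : Measure (EuclideanSpace ℝ (Fin w))} {u : Fin ℓ → ℕ → ℕ} {ε C : ℝ}

/-- Covariances of a power of the norm, with a free truncation level `T`. -/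
theorem IsWeaklyDependent.integral_norm_pow_mul_le (hX : IsWeaklyDependent P 𝓕 X μ C) {s : ℕ}
    (hs : MemLp (fun x => ‖x‖ ^ (s + 1)) 2 μ) :
    ∃ D : ℝ, 0 ≤ D ∧ ∀ (T : ℝ), 1 ≤ T → ∀ t₁ t₂ j : ℕ, t₁ + 3 * j ≤ t₂ →
      ∫ ω, (‖X t₁ ω‖ ^ s - ∫ x, ‖x‖ ^ s ∂μ) * (‖X t₂ ω‖ ^ s - ∫ x, ‖x‖ ^ s ∂μ) ∂P ≤
        D * (T ^ (2 * s) * sqrtRate j + 1 / T) := by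
  have := hX.isProbabilityMeasure
  have hC := hX.rate.nonneg
  set M := ∫ x, ‖x‖ ^ s ∂μ with hM
  set H := ∫ x, ‖x‖ ^ (s + 1) ∂μ with hH
  have hH0 : 0 ≤ H := integral_nonneg fun x => by positivity
  have hM0 : 0 ≤ M := integral_nonneg fun x => by positivity
  -- `Q` is chosen to dominate the centered power, its centered truncation and `T` times their
  -- difference, for every `T ≥ 1` at once.
  set Q : EuclideanSpace ℝ (Fin w) → ℝ := fun x => ‖x‖ ^ (s + 1) + (1 + M + H) with hQ
  have hQc : Continuous Q := by fun_prop
  have hQ2 : MemLp Q 2 μ := hs.add (memLp_const _)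
  have hHi : Integrable (fun x => ‖x‖ ^ (s + 1)) μ := hs.integrable one_le_two
  have hMi : Integrable (fun x => ‖x‖ ^ s) μ := by
    refine (hHi.add (integrable_const 1)).mono' (by fun_prop) (Eventually.of_forall fun x => ?_)
    rw [norm_pow, norm_norm]
    exact pow_le_pow_succ_add_one (norm_nonneg x) s
  have hQX : ∀ t, MemLp (fun ω => Q (X t ω)) 2 P := fun t => by
    rw [← hX.map_eq t] at hQ2
    exact hQ2.comp_of_map (hX.measurable t).aemeasurable
  have hQsq : ∀ t, ∫ ω, Q (X t ω) ^ 2 ∂P = ∫ x, Q x ^ 2 ∂μ := fun t =>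
    hX.integral_comp (f := fun x => Q x ^ 2) (hQc.pow 2) t
  set q := ∫ x, Q x ^ 2 ∂μ with hq
  have hq0 : 0 ≤ q := integral_nonneg fun x => sq_nonneg _
  -- the product of two functions dominated by `Q`
  have hdom : ∀ (f g : EuclideanSpace ℝ (Fin w) → ℝ) {a : ℝ} (t₁ t₂ : ℕ), Continuous f →
      Continuous g → 0 ≤ a → (∀ x, |f x| ≤ a * Q x) → (∀ x, |g x| ≤ Q x) →
      Integrable (fun ω => f (X t₁ ω) * g (X t₂ ω)) P ∧
        ∫ ω, f (X t₁ ω) * g (X t₂ ω) ∂P ≤ a * q := by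
    intro f g a t₁ t₂ hf hg ha hfQ hgQ
    have hQ0 : ∀ x, 0 ≤ Q x := fun x => (abs_nonneg _).trans (hgQ x)
    have hb : ∀ ω, |f (X t₁ ω) * g (X t₂ ω)| ≤ a * ((Q (X t₁ ω) ^ 2 + Q (X t₂ ω) ^ 2) / 2) :=
      fun ω => by
        rw [abs_mul]
        have h1 := mul_le_mul (hfQ (X t₁ ω)) (hgQ (X t₂ ω)) (abs_nonneg _)
          (mul_nonneg ha (hQ0 _))
        refine h1.trans ?_
        rw [mul_assoc]
        refine mul_le_mul_of_nonneg_left ?_ ha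
        nlinarith [sq_nonneg (Q (X t₁ ω) - Q (X t₂ ω))]
    have i1 : Integrable (fun ω => a * ((Q (X t₁ ω) ^ 2 + Q (X t₂ ω) ^ 2) / 2)) P :=
      (((hQX t₁).integrable_sq.add (hQX t₂).integrable_sq).div_const 2).const_mul a
    have i2 : Integrable (fun ω => f (X t₁ ω) * g (X t₂ ω)) P :=
      i1.mono' ((hf.measurable.comp (hX.measurable t₁)).mul
        (hg.measurable.comp (hX.measurable t₂))).aestronglyMeasurable (Eventually.of_forall hb)
    refine ⟨i2, (integral_mono i2 i1 fun ω => (le_abs_self _).trans (hb ω)).trans (le_of_eq ?_)⟩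
    rw [integral_const_mul, integral_div, integral_add (hQX t₁).integrable_sq
      (hQX t₂).integrable_sq, hQsq, hQsq]
    ring
  refine ⟨(2 * s + 4 * s + 4) * C + 2 * q, add_nonneg (by positivity) (by linarith), fun T hT t₁ t₂ j hj => ?_⟩
  have hT0 : 0 < T := by linarith
  have hTs : 0 < T ^ s := by positivity
  set f : EuclideanSpace ℝ (Fin w) → ℝ := fun x => min ‖x‖ T ^ s with hf
  have hfB : IsBddLip f (T ^ s) (s * T ^ s) := IsBddLip.min_norm_pow s hT
  have hf0 : ∀ x, 0 ≤ f x := fun x => pow_nonneg (le_min (norm_nonneg x) hT0.le) s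
  have hfle : ∀ x, f x ≤ ‖x‖ ^ s := fun x =>
    pow_le_pow_left₀ (le_min (norm_nonneg x) hT0.le) (min_le_left _ _) s
  have hfi : Integrable f μ := integrable_of_abs_le hfB.continuous.measurable hfB.bdd
  set c := ∫ x, f x ∂μ with hc
  have hc0 : 0 ≤ c := integral_nonneg hf0
  have hcM : c ≤ M := integral_mono hfi hMi hfle
  have hcT : c ≤ T ^ s := by
    have := integral_mono hfi (integrable_const (T ^ s)) fun x => (abs_le.1 (hfB.bdd x)).2
    simpa using this
  have hcM' : M - c ≤ H / T := by
    rw [hM, hc, hH, ← integral_sub hMi hfi, ← integral_div]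
    exact integral_mono (hMi.sub hfi) (hHi.div_const T) fun x => norm_pow_sub_min_norm_pow_le s hT x
  set g : EuclideanSpace ℝ (Fin w) → ℝ := fun x => f x - c with hg
  have hgB : IsBddLip g (2 * T ^ s) (s * T ^ s) :=
    (hfB.sub_const c).mono (by rw [abs_of_nonneg hc0]; linarith) le_rfl
  have hg0 : ∫ x, g x ∂μ = 0 := by
    rw [hg, integral_sub hfi (integrable_const _)]
    simp [hc]
  set φ : EuclideanSpace ℝ (Fin w) → ℝ := fun x => ‖x‖ ^ s - M with hφ
  have hφc : Continuous φ := by fun_prop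
  have hφQ : ∀ x, |φ x| ≤ Q x := fun x => by
    have h1 := pow_le_pow_succ_add_one (norm_nonneg x) s
    have h2 : 0 ≤ ‖x‖ ^ s := by positivity
    have h3 : 0 ≤ ‖x‖ ^ (s + 1) := by positivity
    rw [abs_le]
    simp only [hφ, hQ]
    constructor <;> linarith
  have hgQ : ∀ x, |g x| ≤ Q x := fun x => by
    have h1 := pow_le_pow_succ_add_one (norm_nonneg x) s
    have h2 := hfle x
    have h3 : 0 ≤ ‖x‖ ^ (s + 1) := by positivity
    have h4 := hf0 x
    rw [abs_le]
    simp only [hg, hQ]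
    constructor <;> linarith
  have hρQ : ∀ x, |φ x - g x| ≤ 1 / T * Q x := fun x => by
    have h1 : ‖x‖ ^ s - f x ≤ ‖x‖ ^ (s + 1) / T := norm_pow_sub_min_norm_pow_le s hT x
    have h2 := hfle x
    have h3 : 0 ≤ ‖x‖ ^ (s + 1) / T := by positivity
    have h4 : 0 ≤ H / T := div_nonneg hH0 hT0.le
    have h5 : 0 ≤ (1 + M) / T := div_nonneg (by linarith) hT0.le
    have h6 : 1 / T * Q x = ‖x‖ ^ (s + 1) / T + (1 + M) / T + H / T := by
      simp only [hQ]; ring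
    rw [abs_le, h6]
    simp only [hφ, hg]
    constructor <;> linarith
  have hρc : Continuous fun x => φ x - g x := hφc.sub hgB.continuous
  obtain ⟨i1, b1⟩ := hdom (fun x => φ x - g x) φ (a := 1 / T) t₁ t₂ hρc hφc (by positivity) hρQ hφQ
  obtain ⟨i2, b2⟩ := hdom (fun x => φ x - g x) g (a := 1 / T) t₂ t₁ hρc hgB.continuous (by positivity) hρQ hgQ
  obtain ⟨i3, -⟩ := hdom g g (a := 1) t₁ t₂ hgB.continuous hgB.continuous zero_le_one
    (fun x => by rw [one_mul]; exact hgQ x) hgQ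
  have hL : 0 ≤ s * T ^ s := by positivity
  have hgt : ∫ ω, g (X t₂ ω) ∂P = 0 := (hX.integral_comp hgB.continuous t₂).trans hg0
  have hpast : IsPastApprox P 𝓕 t₁ (2 * T ^ s) (s * T ^ s * C) (fun ω => g (X t₁ ω)) :=
    hX.rate.isPastApprox_comp hX.family hX.measurable hX.integrable hgB hL le_rfl
  have b3 := hX.rate.abs_integral_pastApprox_mul_le hX.family hX.measurable hX.integrable
    hgB hL (mul_pos two_pos hTs) hgt hpast hj
  -- The two terms containing `φ - g` are of order `1 / T`; the last is a covariance of bounded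
  -- Lipschitz functions, whose bounds and Lipschitz constants contribute `T ^ (2 * s)`.
  have e : ∫ ω, φ (X t₁ ω) * φ (X t₂ ω) ∂P =
      ∫ ω, (φ (X t₁ ω) - g (X t₁ ω)) * φ (X t₂ ω) ∂P +
      ∫ ω, (φ (X t₂ ω) - g (X t₂ ω)) * g (X t₁ ω) ∂P + ∫ ω, g (X t₁ ω) * g (X t₂ ω) ∂P := by
    rw [← integral_add i1 i2, ← integral_add (by exact i1.add i2) i3]
    congr 1
    ext ω
    ring
  change ∫ ω, φ (X t₁ ω) * φ (X t₂ ω) ∂P ≤ _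
  rw [e]
  have hr := sqrtRate_pos j
  have e2 : (2 * T ^ s * (s * T ^ s * C) + 2 * (2 * T ^ s) * (s * T ^ s) * C +
      2 * T ^ s * (2 * T ^ s) * C) * sqrtRate j =
      (2 * s + 4 * s + 4) * C * (T ^ (2 * s) * sqrtRate j) := by
    rw [two_mul s, pow_add]; ring
  rw [e2] at b3
  have h7 : 0 ≤ (2 * s + 4 * s + 4) * C * (1 / T) := by positivity
  have h8 : 0 ≤ 2 * q * (T ^ (2 * s) * sqrtRate j) := mul_nonneg (by linarith) (by positivity)
  have h9 := (le_abs_self _).trans b3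
  linarith

theorem IsWeaklyDependent.satisfiesSLLN_norm_pow (hX : IsWeaklyDependent P 𝓕 X μ C)
    (hε : 0 < ε) (hε1 : ε ≤ 1) (hu : IsSpaced u ε) {s : ℕ}
    (hs : MemLp (fun x => ‖x‖ ^ (s + 1)) 2 μ) (i : Fin ℓ) :
    SatisfiesSLLN P X μ u (fun x => ‖x i‖ ^ s) := by
  have := hX.isProbabilityMeasure
  have hs' : MemLp (fun x => ‖x‖ ^ s) 2 μ := by
    refine (hs.add (memLp_const (1 : ℝ))).of_le (by fun_prop) (Eventually.of_forall fun x => ?_)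
    have h3 : 0 ≤ ‖x‖ ^ (s + 1) + 1 := by positivity
    simp only [Pi.add_apply, norm_pow, norm_norm]
    rw [Real.norm_of_nonneg h3]
    exact pow_le_pow_succ_add_one (norm_nonneg x) s
  have hi := hs'.integrable one_le_two
  have hint : ∫ x, ‖x i‖ ^ s ∂(Measure.pi fun _ : Fin ℓ => μ) = ∫ x, ‖x‖ ^ s ∂μ :=
    integral_comp_eval (μ := fun _ : Fin ℓ => μ) (i := i) hi.aestronglyMeasurable
  refine ⟨integrable_comp_eval (μ := fun _ : Fin ℓ => μ) (i := i) hi, ?_⟩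
  rw [hint]
  set M := ∫ x, ‖x‖ ^ s ∂μ with hM
  obtain ⟨D, hD0, hD⟩ := hX.integral_norm_pow_mul_le hs
  -- With `T = (k + 1) ^ a` this exponent balances the two errors: `2 * s * a - 1 / 2 = -a`.
  set a : ℝ := 1 / (4 * s + 2) with ha
  have ha0 : 0 < a := by positivity
  have ha1 : a < 1 := by
    rw [ha, div_lt_one (by positivity)]
    have : (0 : ℝ) ≤ s := Nat.cast_nonneg s
    linarith
  have key : ∀ᵐ ω ∂P, Tendsto (fun N : ℕ =>
      (∑ n ∈ Finset.range N, (‖X (u i (n + 1)) ω‖ ^ s - M)) / N) atTop (𝓝 0) := by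
    refine ae_tendsto_average_of_correlation_decay (B := M)
      (C := D * ((ε / 6) ^ (-(1 / 2) : ℝ) + 1)) (δ := a)
      (Y := fun n ω => ‖X (u i (n + 1)) ω‖ ^ s - M) ha0 ha1 (fun n => ?_) (fun n ω => ?_)
      fun n k => ?_
    · rw [← hX.map_eq (u i (n + 1))] at hs'
      exact (hs'.comp_of_map (hX.measurable _).aemeasurable).sub (memLp_const M)
    · have : 0 ≤ ‖X (u i (n + 1)) ω‖ ^ s := by positivity
      linarith
    · have hk : (0 : ℝ) < (k : ℝ) + 1 := by positivity
      have hk1 : (1 : ℝ) ≤ (k : ℝ) + 1 := by linarith [Nat.cast_nonneg (α := ℝ) k]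
      have hst : u i (n + 1) + 3 * ⌊ε * k / 3⌋₊ ≤ u i (n + k + 1) := by
        have h1 := hu.add_mul_le (show 1 ≤ n + 1 by omega) i k
        rw [show n + 1 + k = n + k + 1 by ring] at h1
        have h2 := Nat.floor_le (show 0 ≤ ε * k / 3 by positivity)
        have : (u i (n + 1) : ℝ) + 3 * ⌊ε * k / 3⌋₊ ≤ u i (n + k + 1) := by linarith
        exact_mod_cast this
      refine (hD (((k : ℝ) + 1) ^ a) (Real.one_le_rpow hk1 ha0.le) _ _ _ hst).trans ?_
      rw [mul_assoc]
      refine mul_le_mul_of_nonneg_left ?_ hD0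
      rw [add_mul, one_mul]
      refine add_le_add ?_ (le_of_eq ?_)
      · refine (mul_le_mul_of_nonneg_left (sqrtRate_floor_le hε hε1 k) (by positivity)).trans
          (le_of_eq ?_)
        rw [← Real.rpow_natCast, ← Real.rpow_mul hk.le, mul_left_comm, ← Real.rpow_add hk]
        congr 2
        rw [ha]
        push_cast
        field_simp
        ring
      · rw [Real.rpow_neg hk.le, one_div]
  filter_upwards [key] with ω hω
  have h1 := hω.add_const M
  rw [zero_add] at h1
  refine h1.congr' ?_
  filter_upwards [eventually_gt_atTop 0] with N hN
  have : (N : ℝ) ≠ 0 := by exact_mod_cast hN.ne'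
  rw [Finset.sum_sub_distrib, Finset.sum_const, Finset.card_range, nsmul_eq_mul]
  field_simp
  ring

end

/-! ### Clipping and Stone-Weierstrass approximation -/

/-- Truncation of all coordinates of a vector at the levels `-R` and `R`. -/
noncomputable def coordClip {w : ℕ} (R : ℝ) (x : EuclideanSpace ℝ (Fin w)) :
    EuclideanSpace ℝ (Fin w) :=
  WithLp.toLp 2 fun a => max (-R) (min (x a) R)

section

variable {w : ℕ} {R : ℝ}

theorem norm_coordClip_sub_le (x y : EuclideanSpace ℝ (Fin w)) :
    ‖coordClip R x - coordClip R y‖ ≤ ‖x - y‖ := by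
  rw [EuclideanSpace.norm_eq, EuclideanSpace.norm_eq]
  refine Real.sqrt_le_sqrt (Finset.sum_le_sum fun a _ => ?_)
  refine pow_le_pow_left₀ (norm_nonneg _) ?_ 2
  simp only [coordClip, PiLp.sub_apply, Real.norm_eq_abs]
  refine (abs_max_sub_max_le_max _ _ _ _).trans (max_le (by simp) ?_)
  exact (abs_min_sub_min_le_max _ _ _ _).trans (max_le le_rfl (by simp))

theorem norm_coordClip_le (hR : 0 ≤ R) (x : EuclideanSpace ℝ (Fin w)) :
    ‖coordClip R x‖ ≤ ‖x‖ := by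
  have h : coordClip R (0 : EuclideanSpace ℝ (Fin w)) = 0 := by
    ext a
    simp [coordClip, hR]
  simpa [h] using norm_coordClip_sub_le (R := R) x 0

theorem coordClip_eq_self {x : EuclideanSpace ℝ (Fin w)} (hx : ‖x‖ ≤ R) : coordClip R x = x := by
  ext a
  have h := abs_le.1 ((PiLp.norm_apply_le x a).trans hx)
  simp only [coordClip]
  rw [min_eq_left h.2, max_eq_right h.1]

theorem coordClip_mem_closedBall (hR : 0 ≤ R) (x : EuclideanSpace ℝ (Fin w)) :
    coordClip R x ∈ Metric.closedBall (0 : EuclideanSpace ℝ (Fin w)) (Real.sqrt (w * R ^ 2)) := by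
  rw [mem_closedBall_zero_iff, EuclideanSpace.norm_eq]
  refine Real.sqrt_le_sqrt ?_
  refine (Finset.sum_le_card_nsmul _ _ (R ^ 2) fun a _ => ?_).trans (by simp)
  refine pow_le_pow_left₀ (norm_nonneg _) ?_ 2
  simp only [coordClip, Real.norm_eq_abs, abs_le]
  exact ⟨le_max_left _ _, max_le (by linarith) (min_le_right _ _)⟩

theorem IsBddLip.comp_coordClip {f : EuclideanSpace ℝ (Fin w) → ℝ} {B Λ : ℝ}
    (hf : IsBddLip f B Λ) : IsBddLip (fun x => f (coordClip R x)) B |Λ| := by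
  refine ⟨fun x => hf.bdd _, fun x y => (hf.lip _ _).trans ?_⟩
  exact mul_le_mul (le_abs_self Λ) (norm_coordClip_sub_le x y) (norm_nonneg _) (abs_nonneg _)

end

/-- The continuous functions that depend on one of the variables only, in a bounded Lipschitz
way. -/
def oneVariableFunctions (ℓ : ℕ) (E : Type*) [NormedAddCommGroup E] : Set C(Fin ℓ → E, ℝ) :=
  {h | ∃ (j : Fin ℓ) (f : E → ℝ) (B Λ : ℝ), IsBddLip f B Λ ∧ ∀ x, h x = f (x j)}

theorem separatesPoints_oneVariableFunctions (ℓ : ℕ) (E : Type*) [NormedAddCommGroup E] :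
    (Algebra.adjoin ℝ (oneVariableFunctions ℓ E)).SeparatesPoints := by
  intro x y hxy
  obtain ⟨j, hj⟩ := Function.ne_iff.1 hxy
  have hc : Continuous fun z : Fin ℓ → E => min ‖z j - x j‖ 1 := by fun_prop
  refine ⟨_, ⟨⟨_, hc⟩, Algebra.subset_adjoin
    ⟨j, fun z => min ‖z - x j‖ 1, 1, 1, ⟨fun z => ?_, fun z z' => ?_⟩, fun _ => rfl⟩, rfl⟩, ?_⟩
  · rw [abs_of_nonneg (le_min (norm_nonneg _) zero_le_one)]
    exact min_le_right _ _
  · refine (abs_inf_sub_inf_le_abs _ _ _).trans ((abs_norm_sub_norm_le _ _).trans ?_)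
    rw [sub_sub_sub_cancel_right, one_mul]
  · have h0 : 0 < ‖y j - x j‖ := norm_pos_iff.2 (sub_ne_zero.2 fun h => hj h.symm)
    simp only [ContinuousMap.coe_mk, sub_self, norm_zero]
    rw [min_eq_left zero_le_one]
    exact (lt_min h0 one_pos).ne

/-- Factors in the same variable are merged, since bounded Lipschitz functions are closed under
products; absent variables get the factor one. -/
theorem exists_prod_of_mem_closure {ℓ : ℕ} {E : Type*} [NormedAddCommGroup E]
    {h : C(Fin ℓ → E, ℝ)} (hh : h ∈ Submonoid.closure (oneVariableFunctions ℓ E)) :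
    ∃ (f : Fin ℓ → E → ℝ) (B Λ : ℝ), (∀ j, IsBddLip (f j) B Λ) ∧ ∀ x, h x = ∏ j, f j (x j) := by
  classical
  induction hh using Submonoid.closure_induction with
  | mem h hh =>
    obtain ⟨j, f, B, Λ, hf, hx⟩ := hh
    refine ⟨Function.update (fun _ _ => 1) j f, max B |1|, max Λ 0, fun i => ?_, fun x => ?_⟩
    · rcases eq_or_ne i j with rfl | hij
      · rw [Function.update_self]
        exact hf.mono (le_max_left _ _) (le_max_left _ _)
      · rw [Function.update_of_ne hij]
        exact (IsBddLip.const 1).mono (le_max_right _ _) (le_max_right _ _)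
    · rw [hx, ← Finset.mul_prod_erase _ _ (Finset.mem_univ j), Function.update_self,
        Finset.prod_eq_one, mul_one]
      intro i hi
      rw [Function.update_of_ne (Finset.ne_of_mem_erase hi)]
  | one => exact ⟨fun _ _ => 1, |1|, 0, fun _ => IsBddLip.const 1, fun x => by simp⟩
  | mul h₁ h₂ _ _ ih₁ ih₂ =>
    obtain ⟨f, B, Λ, hf, hx⟩ := ih₁
    obtain ⟨g, B', Λ', hg, hx'⟩ := ih₂
    refine ⟨fun j x => f j x * g j x, _, _, fun j => (hf j).mul (hg j), fun x => ?_⟩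
    rw [ContinuousMap.mul_apply, hx, hx', Finset.prod_mul_distrib]

/-- The generated algebra is the linear span of the monomials, and these are products of
one-variable functions. Clipping is a contraction and preserves that form. -/
theorem IsWeaklyDependent.satisfiesSLLN_adjoin_comp_clip {Ω : Type*} [MeasurableSpace Ω]
    {P : Measure Ω} [IsProbabilityMeasure P] {ℓ w : ℕ} {𝓕 : ℕ → ℕ∞ → MeasurableSpace Ω}
    {X : ℕ → Ω → EuclideanSpace ℝ (Fin w)} {μ : Measure (EuclideanSpace ℝ (Fin w))}
    {u : Fin ℓ → ℕ → ℕ} {ε C : ℝ} (hX : IsWeaklyDependent P 𝓕 X μ C)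
    (hε : 0 < ε) (hε1 : ε ≤ 1) (hu : IsSpaced u ε) (R : ℝ)
    {A : C(Fin ℓ → EuclideanSpace ℝ (Fin w), ℝ)}
    (hA : A ∈ Algebra.adjoin ℝ (oneVariableFunctions ℓ (EuclideanSpace ℝ (Fin w)))) :
    SatisfiesSLLN P X μ u (fun x => A fun j => coordClip R (x j)) := by
  have := hX.isProbabilityMeasure
  rw [← Subalgebra.mem_toSubmodule, Algebra.adjoin_eq_span] at hA
  induction hA using Submodule.span_induction with
  | mem h hh =>
    obtain ⟨f, B, Λ, hf, hx⟩ := exists_prod_of_mem_closure hh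
    simp only [hx]
    exact hX.satisfiesSLLN_prod hε hε1 hu (f := fun j x => f j (coordClip R x))
      fun j => (hf j).comp_coordClip
  | zero => exact SatisfiesSLLN.const 0
  | add h₁ h₂ _ _ ih₁ ih₂ => exact ih₁.add ih₂
  | smul c h _ ih => exact ih.const_mul c

section

variable {ℓ w : ℕ} {F : (Fin ℓ → EuclideanSpace ℝ (Fin w)) → ℝ} {ι K κ : ℝ}

theorem IsHolderPolyGrowth.continuous (hF : IsHolderPolyGrowth F ι K κ) (hι : 0 < ι)
    (hκ : 0 < κ) : Continuous F := by
  refine continuous_iff_continuousAt.2 fun x => ?_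
  rw [ContinuousAt, tendsto_iff_norm_sub_tendsto_zero]
  have hc : Continuous fun y : Fin ℓ → EuclideanSpace ℝ (Fin w) =>
      K * (1 + ∑ j, ‖y j‖ ^ ι + ∑ j, ‖x j‖ ^ ι) * ∑ j, ‖y j - x j‖ ^ κ := by
    have h1 : ∀ j : Fin ℓ, Continuous fun y : Fin ℓ → EuclideanSpace ℝ (Fin w) => ‖y j‖ ^ ι :=
      fun j => (continuous_apply j).norm.rpow_const fun _ => Or.inr hι.le
    have h2 : ∀ j : Fin ℓ, Continuous fun y : Fin ℓ → EuclideanSpace ℝ (Fin w) =>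
        ‖y j - x j‖ ^ κ :=
      fun j => ((continuous_apply j).sub continuous_const).norm.rpow_const fun _ => Or.inr hκ.le
    exact (continuous_const.mul ((continuous_const.add (continuous_finsetSum _ fun j _ =>
      h1 j)).add continuous_const)).mul (continuous_finsetSum _ fun j _ => h2 j)
  have h0 := hc.tendsto x
  simp only [sub_self, norm_zero, Real.zero_rpow hκ.ne', Finset.sum_const_zero, mul_zero] at h0
  exact squeeze_zero (fun y => norm_nonneg _) (fun y => hF.holder y x) h0

theorem rpow_le_rpow_neg_mul_pow {a R : ℝ} {s : ℕ} (hR : 1 ≤ R) (haR : R ≤ a) (hs : ι ≤ s) :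
    a ^ ι ≤ R ^ (-((s : ℝ) - ι)) * a ^ s := by
  have hR0 : 0 < R := by linarith
  have ha0 : 0 < a := by linarith
  rw [Real.rpow_neg hR0.le, inv_mul_eq_div, le_div_iff₀ (by positivity)]
  calc a ^ ι * R ^ ((s : ℝ) - ι) ≤ a ^ ι * a ^ ((s : ℝ) - ι) := by
        refine mul_le_mul_of_nonneg_left ?_ (by positivity)
        exact Real.rpow_le_rpow hR0.le haR (by linarith)
    _ = a ^ s := by rw [← Real.rpow_add ha0, add_sub_cancel, Real.rpow_natCast]

/-- Clipping matters only if some `‖x i‖ > R`. That coordinate satisfies `‖x i‖ ^ ι ≤ R ^ (-(s - ι))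
* ‖x i‖ ^ s`, and the right side also controls `1` and the powers of all coordinates of norm at most
`R`, since these are at most `R ^ ι`. The growth bound then finishes. -/
theorem IsHolderPolyGrowth.abs_sub_comp_clip_le (hF : IsHolderPolyGrowth F ι K κ) (hι : 0 < ι)
    (hK : 0 < K) {s : ℕ} (hs : ι ≤ s) {R : ℝ} (hR : 1 ≤ R)
    (x : Fin ℓ → EuclideanSpace ℝ (Fin w)) :
    |F x - F fun j => coordClip R (x j)| ≤
      2 * K * (ℓ + 1) * R ^ (-((s : ℝ) - ι)) * ∑ j, ‖x j‖ ^ s := by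
  have hR0 : 0 < R := by linarith
  have hsum : 0 ≤ ∑ j, ‖x j‖ ^ s := Finset.sum_nonneg fun j _ => by positivity
  by_cases hx : ∀ j, ‖x j‖ ≤ R
  · simp only [coordClip_eq_self (hx _), sub_self, abs_zero]
    positivity
  push Not at hx
  obtain ⟨i, hi⟩ := hx
  set t := R ^ (-((s : ℝ) - ι)) with ht
  have ht0 : 0 < t := by positivity
  have hle : ∀ j, ‖x j‖ ^ s ≤ ∑ j, ‖x j‖ ^ s := fun j =>
    Finset.single_le_sum (f := fun j => ‖x j‖ ^ s) (fun _ _ => by positivity) (Finset.mem_univ j)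
  have hbig : ∀ j, R ≤ ‖x j‖ → ‖x j‖ ^ ι ≤ t * ∑ j, ‖x j‖ ^ s := fun j hj =>
    (rpow_le_rpow_neg_mul_pow hR hj hs).trans (mul_le_mul_of_nonneg_left (hle j) ht0.le)
  have hRi : R ^ ι ≤ t * ∑ j, ‖x j‖ ^ s :=
    (Real.rpow_le_rpow hR0.le hi.le hι.le).trans (hbig i hi.le)
  have hall : ∀ j, ‖x j‖ ^ ι ≤ t * ∑ j, ‖x j‖ ^ s := fun j => by
    rcases le_total R ‖x j‖ with h | h
    · exact hbig j h
    · exact (Real.rpow_le_rpow (norm_nonneg _) h hι.le).trans hRi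
  have h1 : 1 + ∑ j, ‖x j‖ ^ ι ≤ (ℓ + 1) * (t * ∑ j, ‖x j‖ ^ s) := by
    have e1 : (1 : ℝ) ≤ t * ∑ j, ‖x j‖ ^ s := (Real.one_le_rpow hR hι.le).trans hRi
    have e2 := Finset.sum_le_card_nsmul Finset.univ (fun j => ‖x j‖ ^ ι) _ fun j _ => hall j
    simp only [Finset.card_univ, Fintype.card_fin, nsmul_eq_mul] at e2
    linarith
  have h2 : 1 + ∑ j, ‖coordClip R (x j)‖ ^ ι ≤ 1 + ∑ j, ‖x j‖ ^ ι := by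
    gcongr with j
    exact norm_coordClip_le hR0.le (x j)
  have h3 := hF.growth x
  have h4 := hF.growth fun j => coordClip R (x j)
  have h5 := mul_le_mul_of_nonneg_left h1 hK.le
  have h6 := mul_le_mul_of_nonneg_left h2 hK.le
  refine (abs_sub _ _).trans ?_
  linarith

end

theorem IsWeaklyDependent.satisfiesSLLN_of_holder {Ω : Type*} [MeasurableSpace Ω]
    {P : Measure Ω} [IsProbabilityMeasure P] {ℓ w : ℕ} {𝓕 : ℕ → ℕ∞ → MeasurableSpace Ω}
    {X : ℕ → Ω → EuclideanSpace ℝ (Fin w)} {μ : Measure (EuclideanSpace ℝ (Fin w))}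
    {u : Fin ℓ → ℕ → ℕ} {ε C : ℝ} (hX : IsWeaklyDependent P 𝓕 X μ C)
    (hε : 0 < ε) (hε1 : ε ≤ 1) (hu : IsSpaced u ε)
    {F : (Fin ℓ → EuclideanSpace ℝ (Fin w)) → ℝ} {ι K κ : ℝ} (hι : 0 < ι) (hK : 0 < K)
    (hκ : 0 < κ) (hF : IsHolderPolyGrowth F ι K κ) {s : ℕ} (hs : ι < s)
    (hμ : MemLp (fun x => ‖x‖ ^ (s + 1)) 2 μ) : SatisfiesSLLN P X μ u F := by
  have := hX.isProbabilityMeasure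
  have hW : SatisfiesSLLN P X μ u (fun x => 1 + ∑ j, ‖x j‖ ^ s) :=
    (SatisfiesSLLN.const 1).add
      (SatisfiesSLLN.sum _ fun i _ => hX.satisfiesSLLN_norm_pow hε hε1 hu hμ i)
  have hsum : ∀ x : Fin ℓ → EuclideanSpace ℝ (Fin w), 0 ≤ ∑ j, ‖x j‖ ^ s := fun x =>
    Finset.sum_nonneg fun j _ => by positivity
  have hFc := hF.continuous hι hκ
  refine hW.of_approx (fun x => add_nonneg zero_le_one (hsum x)) hFc fun δ hδ => ?_
  have hlim : Tendsto (fun R : ℝ => 2 * K * (ℓ + 1) * R ^ (-((s : ℝ) - ι))) atTop (𝓝 0) := by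
    simpa using (tendsto_rpow_neg_atTop (sub_pos.2 hs)).const_mul (2 * K * (ℓ + 1))
  obtain ⟨R, hRδ, hR⟩ := ((hlim.eventually_le_const (half_pos hδ)).and
    (eventually_ge_atTop 1)).exists
  -- All clipped points lie in a fixed compact product of balls, so uniform approximation there
  -- holds for every `x` after clipping. Its error `δ / 2` is absorbed by the summand `1` of the
  -- weight.
  obtain ⟨A, hA, hAF⟩ :=
    ContinuousMap.exists_mem_subalgebra_near_continuous_of_isCompact_of_separatesPoints
      (separatesPoints_oneVariableFunctions ℓ (EuclideanSpace ℝ (Fin w))) ⟨F, hFc⟩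
      (isCompact_univ_pi fun _ : Fin ℓ => isCompact_closedBall
        (0 : EuclideanSpace ℝ (Fin w)) (Real.sqrt (w * R ^ 2))) (half_pos hδ)
  refine ⟨_, hX.satisfiesSLLN_adjoin_comp_clip hε hε1 hu R hA, fun x => ?_⟩
  have h1 := hF.abs_sub_comp_clip_le hι hK hs.le hR x
  have h2 := hAF (fun j => coordClip R (x j))
    fun j _ => coordClip_mem_closedBall (by linarith) (x j)
  rw [Real.norm_eq_abs, abs_sub_comm] at h2
  have h3 := mul_le_mul_of_nonneg_right hRδ (hsum x)
  have h4 := mul_nonneg hδ.le (hsum x)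
  refine (abs_sub_le _ (F fun j => coordClip R (x j)) _).trans ?_
  simp only [ContinuousMap.coe_mk] at h2
  linarith

/-! ### Moments and conclusion -/

theorem sum_Icc_one_eq_sum_range {M : Type*} [AddCommMonoid M] (f : ℕ → M) (N : ℕ) :
    ∑ n ∈ Finset.Icc 1 N, f n = ∑ n ∈ Finset.range N, f (n + 1) := by
  induction N with
  | zero => simp
  | succ N ih => rw [Finset.sum_Icc_succ_top (by omega), ih, Finset.sum_range_succ]

theorem memLp_norm_pow_two_of_memLp {E : Type*} [NormedAddCommGroup E] [MeasurableSpace E]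
    [OpensMeasurableSpace E] {μ : Measure E} [IsFiniteMeasure μ] {r : ℝ≥0∞} {k : ℕ}
    (h : MemLp (fun x : E => x) r μ) (hk : ((2 * k : ℕ) : ℝ≥0∞) ≤ r) :
    MemLp (fun x : E => ‖x‖ ^ k) 2 μ := by
  rw [memLp_two_iff_integrable_sq (by fun_prop)]
  simp only [← pow_mul, mul_comm k]
  exact (h.mono_exponent hk).integrable_norm_pow'

theorem theorem2p2 {Ω : Type*} [MeasurableSpace Ω] (P : Measure Ω) [IsProbabilityMeasure P]
    (ℓ w : ℕ) (hℓ : 1 ≤ ℓ)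
    (𝓕 : ℕ → ℕ∞ → MeasurableSpace Ω) (h𝓕 : IsIntervalFamily P 𝓕)
    (X : ℕ → Ω → EuclideanSpace ℝ (Fin w)) (hX : ∀ n, Measurable (X n))
    (μ : Measure (EuclideanSpace ℝ (Fin w))) (hμ : ∀ n, P.map (X n) = μ)
    (F : (Fin ℓ → EuclideanSpace ℝ (Fin w)) → ℝ)
    (ι K κ : ℝ) (hι : 0 < ι) (hK : 0 < K) (hκ : 0 < κ) (hκ1 : κ ≤ 1)
    (hF : IsHolderPolyGrowth F ι K κ)
    (u : Fin ℓ → ℕ → ℕ) (ε : ℝ) (hε : 0 < ε) (hε1 : ε ≤ 1) (hu : IsSpaced u ε)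
    (hA : MixingMomentAssumption P 𝓕 X μ ℓ ι κ) :
    Integrable F (Measure.pi fun _ : Fin ℓ => μ) ∧
      ∀ᵐ ω ∂P, Tendsto (fun N : ℕ => (1 / (N : ℝ)) * nonconventionalSum F X u N ω) atTop
        (𝓝 (∫ x, F x ∂(Measure.pi fun _ : Fin ℓ => μ))) := by
  obtain ⟨p, q, θ, m, hp, hq, hθ, hm, hθκ, hpq, hmom, hsize⟩ := hA
  have hμP : IsProbabilityMeasure μ := by
    rw [← hμ 0]
    exact Measure.isProbabilityMeasure_map (hX 0).aemeasurable
  have hθ1 : θ ≤ 1 := by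
    have h1 : (0 : ℝ) ≤ (ℓ : ℝ) - 1 := sub_nonneg.2 (by exact_mod_cast hℓ)
    have : 0 ≤ ((ℓ : ℝ) - 1) * w * (p⁻¹).toReal := by positivity
    linarith
  have hm2 : 2 * (ι + 2) ≤ m := by
    have h1 : 0 ≤ (p⁻¹).toReal := ENNReal.toReal_nonneg
    have h2 : 0 ≤ θ * (q⁻¹).toReal := by positivity
    have h3 : (ι + 2) / m ≤ 1 / 2 := by linarith
    rw [div_le_iff₀ hm] at h3
    linarith
  have hLp : MemLp (fun x : EuclideanSpace ℝ (Fin w) => x) (ENNReal.ofReal m) μ :=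
    ⟨by fun_prop, lt_of_le_of_lt le_self_add hmom⟩
  have hLp1 : Integrable (fun x : EuclideanSpace ℝ (Fin w) => x) μ :=
    hLp.integrable (by rw [ENNReal.one_le_ofReal]; linarith)
  have hXi : ∀ n, Integrable (X n) P := fun n => by
    rw [← hμ n] at hLp1
    exact hLp1.comp_measurable (hX n)
  have hXM : ∀ n, ∫ ω, ‖X n ω‖ ∂P ≤ ∫ x, ‖x‖ ∂μ := fun n => by
    rw [← hμ n, integral_map (hX n).aemeasurable continuous_norm.aestronglyMeasurable]
  obtain ⟨C, hC⟩ : ∃ C, HasSqrtRate P 𝓕 X C := by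
    rcases hsize with h | h
    · exact HasSqrtRate.of_isOfSizeNegHalf h𝓕 hXi hXM hp hq hθ hθ1 h
    · exact HasSqrtRate.of_isOfSizeNegHalf h𝓕 hXi hXM hq hq hθ hθ1 h
  have hW : IsWeaklyDependent P 𝓕 X μ C := ⟨h𝓕, hX, hμ, hXi, hC⟩
  -- This integer satisfies `ι < s ≤ ι + 1`, so `2 * (s + 1) ≤ 2 * (ι + 2) ≤ m` and the moment of
  -- order `m` suffices.
  set s := ⌊ι⌋₊ + 1 with hs
  have hs1 : ι < s := by
    rw [hs]; push_cast; exact Nat.lt_floor_add_one ι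
  have hs2 : (s : ℝ) ≤ ι + 1 := by
    rw [hs]; push_cast
    linarith [Nat.floor_le hι.le]
  have hs3 : MemLp (fun x : EuclideanSpace ℝ (Fin w) => ‖x‖ ^ (s + 1)) 2 μ := by
    refine memLp_norm_pow_two_of_memLp hLp ?_
    rw [← ENNReal.ofReal_natCast]
    refine ENNReal.ofReal_le_ofReal ?_
    push_cast
    linarith
  obtain ⟨h1, h2⟩ := hW.satisfiesSLLN_of_holder hε hε1 hu hι hK hκ hF hs1 hs3
  refine ⟨h1, ?_⟩
  filter_upwards [h2] with ω hω
  refine hω.congr fun N => ?_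
  rw [nonconventionalSum, sum_Icc_one_eq_sum_range, one_div, div_eq_inv_mul]
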